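/- Let $n\ge 1$ and let $(\mathcal C,\mathbb E,\mathfrak s)$ be a skeletally small $n$-exangulated category (in the sense of Herschend–Liu–Nakaoka) such that $\mathcal C$ has weak kernels. A class $\xi$ of distinguished $n$-exangles that is closed under weak isomorphisms (morphisms of distinguished $n$-exangles whose components on the two end terms are isomorphisms) is called *$n$-proper* if it contains all split distinguished $n$-exangles, is closed under finite coproducts, base change and cobase change, and is saturated, i.e. whenever $\langle X,\delta\rangle$ is a distinguished $n$-exangle, $\langle Y,\rho\rangle\in\xi$ has the same last term $Y^{n+1}=X^{n+1}$, and a distinguished $n$-exangle realizing $(d_Y^n)^*\delta$ lies in $\xi$, then $\langle X,\delta\rangle\in\xi$. For such $\xi$ put $\mathbb E_\xi(C,A)=\{\delta\in\mathbb E(C,A) : \langle X,\delta\rangle\in\xi \text{ for some } X\}$. An additive subbifunctor $\mathbb F\subseteq\mathbb E$ is *closed* if for every complex $X$ realizing an element of $\mathbb F(X^{n+1},X^0)$ the sequences $\mathbb F(-,X^0)\to\mathbb F(-,X^1)\to\mathbb F(-,X^2)$ and $\mathbb F(X^{n+1},-)\to\mathbb F(X^n,-)\to\mathbb F(X^{n-1},-)$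 are exact. Write $\mathrm{def}\,\mathbb F$ for the full subcategory of all functors $\mathcal C^{\mathrm{op}}\to\mathrm{Ab}$ isomorphic to $\operatorname{Coker}\bigl(\mathcal C(-,X^n)\xrightarrow{\mathcal C(-,d_X^n)}\mathcal C(-,X^{n+1})\bigr)$ for some distinguished $n$-exangle $\langle X,\delta\rangle$ with $\delta\in\mathbb F(X^{n+1},X^0)$. A *Serre subcategory* of $\mathrm{def}\,\mathbb E$ is a full subcategory containing a zero object and closed under subobjects, quotients and extensions in $\mathrm{def}\,\mathbb E$. Then there are isomorphisms of posets, all ordered by inclusion, $$\{\,n\text{-proper classes of distinguished } n\text{-exangles}\,\}\;\xrightarrow{\ \sim\ }\;\{\text{closed subbifunctors of }\mathbb E\}\;\xrightarrow{\ \sim\ }\;\{\text{Serre subcategories of }\mathrm{def}\,\mathbb E\},$$ given by $\xi\mapsto\mathbb E_\xi$ and $\mathbb F\mapsto\mathrm{def}\,\mathbb F$. In particular, the $n$-proper classes contained in the class of all distinguished $n$-exangles are in inclusion-preserving (and reflecting) bijection with the Serre subcategories of $\mathrm{def}\,\mathbb E$ via $\xi\mapsto\mathrm{def}\,\mathbb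 E_\xi$. -/

import Mathlib

open CategoryTheory CategoryTheory.Limits Opposite
open scoped ZeroObject

universe w v u

namespace NEx

section Complexes

variable {C : Type u} [Category.{v} C] [Preadditive C]

/-- A complex `A = X⁰ ⟶ X¹ ⟶ ⋯ ⟶ Xⁿ ⟶ Xⁿ⁺¹ = B` of length `n + 2` with prescribed end terms `A`
and `B`: a cochain complex concentrated in degrees `0, …, n + 1`, whose extreme terms are
identified with `A` and `B`. -/
structure Cpx (n : ℕ) (A B : C) where
  /-- the underlying complex -/
  K : CochainComplex C ℕ
  isZero_X : ∀ i : ℕ, n + 1 < i → IsZero (K.X i)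
  /-- the identification of the term of degree `0` with `A` -/
  left : K.X 0 ≅ A
  /-- the identification of the term of degree `n + 1` with `B` -/
  right : K.X (n + 1) ≅ B

namespace Cpx

variable {n : ℕ}

/-- The first differential `A ⟶ X¹`. -/
def dFirst {A B : C} (X : Cpx n A B) : A ⟶ X.K.X 1 := X.left.inv ≫ X.K.d 0 1

/-- The last differential `Xⁿ ⟶ B`. -/
def dLast {A B : C} (X : Cpx n A B) : X.K.X n ⟶ B := X.K.d n (n + 1) ≫ X.right.hom

/-- The morphism of complexes `f` is of the form `(a, f¹, …, fⁿ, c)`. -/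
def IsLift {A B A' B' : C} {X : Cpx n A B} {Y : Cpx n A' B'} (f : X.K ⟶ Y.K)
    (a : A ⟶ A') (c : B ⟶ B') : Prop :=
  f.f 0 ≫ Y.left.hom = X.left.hom ≫ a ∧ f.f (n + 1) ≫ Y.right.hom = X.right.hom ≫ c

lemma isLift_id {A B : C} (X : Cpx n A B) :
    IsLift (X := X) (Y := X) (𝟙 X.K) (𝟙 A) (𝟙 B) := by
  simp [IsLift]

lemma IsLift.comp {A B A' B' A'' B'' : C} {X : Cpx n A B} {Y : Cpx n A' B'} {Z : Cpx n A'' B''}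
    {f : X.K ⟶ Y.K} {g : Y.K ⟶ Z.K} {a : A ⟶ A'} {c : B ⟶ B'} {a' : A' ⟶ A''} {c' : B' ⟶ B''}
    (hf : IsLift (X := X) (Y := Y) f a c) (hg : IsLift (X := Y) (Y := Z) g a' c') :
    IsLift (X := X) (Y := Z) (f ≫ g) (a ≫ a') (c ≫ c') := by
  refine ⟨?_, ?_⟩
  · rw [HomologicalComplex.comp_f, Category.assoc, hg.1, ← Category.assoc, hf.1, Category.assoc]
  · rw [HomologicalComplex.comp_f, Category.assoc, hg.2, ← Category.assoc, hf.2, Category.assoc]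

/-- Homotopy equivalence in the category of complexes from `A` to `B`, whose morphisms are the
morphisms of complexes that are the identity on the end terms `A` and `B`. -/
def HEquiv {A B : C} (X Y : Cpx n A B) : Prop :=
  ∃ e : HomotopyEquiv X.K Y.K,
    IsLift (X := X) (Y := Y) e.hom (𝟙 A) (𝟙 B) ∧ IsLift (X := Y) (Y := X) e.inv (𝟙 A) (𝟙 B)

instance homotopySetoid (n : ℕ) (A B : C) : Setoid (Cpx n A B) where
  r := HEquiv
  iseqv :=
    { refl := fun X => ⟨HomotopyEquiv.refl X.K, isLift_id X, isLift_id X⟩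
      symm := fun ⟨e, h₁, h₂⟩ => ⟨e.symm, h₂, h₁⟩
      trans := fun ⟨e, h₁, h₂⟩ ⟨e', h₁', h₂'⟩ => ⟨e.trans e', by
        simpa using h₁.comp h₁', by simpa using h₂'.comp h₂⟩ }

end Cpx

/-- The class of homotopy equivalence classes `[X]` of complexes from `A` to `B`. -/
abbrev HClass (n : ℕ) (A B : C) := Quotient (Cpx.homotopySetoid n A B)

namespace Cpx

variable {n : ℕ}

section DirectSum

variable [HasBinaryBiproducts C]

/-- The direct sum of two complexes. -/
noncomputable def sum {A B A' B' : C} (X : Cpx n A B) (Y : Cpx n A' B') :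
    Cpx n (A ⊞ A') (B ⊞ B') where
  K := X.K ⊞ Y.K
  isZero_X i hi :=
    IsZero.of_iso ((biprod_isZero_iff _ _).2 ⟨X.isZero_X i hi, Y.isZero_X i hi⟩)
      (HomologicalComplex.biprodXIso X.K Y.K i)
  left := HomologicalComplex.biprodXIso X.K Y.K 0 ≪≫ biprod.mapIso X.left Y.left
  right := HomologicalComplex.biprodXIso X.K Y.K (n + 1) ≪≫ biprod.mapIso X.right Y.right

end DirectSum

section Cone

variable [HasBinaryBiproducts C]

/-- The terms `X¹, X² ⊞ Y¹, X³ ⊞ Y², …` of the mapping cone. -/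
noncomputable def coneX (K L : CochainComplex C ℕ) : ℕ → C
  | 0 => K.X 1
  | i + 1 => K.X (i + 2) ⊞ L.X (i + 1)

/-- The differentials of the mapping cone. -/
noncomputable def coneD {K L : CochainComplex C ℕ} (f : K ⟶ L) :
    ∀ i : ℕ, coneX K L i ⟶ coneX K L (i + 1)
  | 0 => biprod.lift (-K.d 1 2) (f.f 1)
  | i + 1 => biprod.desc (biprod.lift (-K.d (i + 2) (i + 3)) (f.f (i + 2)))
      (biprod.lift 0 (L.d (i + 1) (i + 2)))

lemma coneD_comp {K L : CochainComplex C ℕ} (f : K ⟶ L) (i : ℕ) :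
    coneD f i ≫ coneD f (i + 1) = 0 := by
  cases i with
  | zero =>
    change biprod.lift (-K.d 1 2) (f.f 1) ≫
      biprod.desc (biprod.lift (-K.d 2 3) (f.f 2)) (biprod.lift 0 (L.d 1 2)) =
        (0 : K.X 1 ⟶ K.X 3 ⊞ L.X 2)
    apply biprod.hom_ext <;> simp [biprod.lift_desc]
  | succ i =>
    change biprod.desc (biprod.lift (-K.d (i + 2) (i + 3)) (f.f (i + 2)))
      (biprod.lift 0 (L.d (i + 1) (i + 2))) ≫
      biprod.desc (biprod.lift (-K.d (i + 3) (i + 4)) (f.f (i + 3)))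
      (biprod.lift 0 (L.d (i + 2) (i + 3))) =
        (0 : K.X (i + 2) ⊞ L.X (i + 1) ⟶ K.X (i + 4) ⊞ L.X (i + 3))
    apply biprod.hom_ext' <;> apply biprod.hom_ext <;> simp

/-- The mapping cone `X¹ ⟶ X² ⊞ Y¹ ⟶ ⋯ ⟶ Xⁿ⁺¹ ⊞ Yⁿ ⟶ Yⁿ⁺¹` of a morphism `f : X ⟶ Y` (used for
`f⁰ = 𝟙`). Its term of degree `n + 1` is literally `Xⁿ⁺² ⊞ Yⁿ⁺¹`, where `Xⁿ⁺² = 0`. -/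
noncomputable def cone {A B A' B' : C} {X : Cpx n A B} {Y : Cpx n A' B'} (f : X.K ⟶ Y.K) :
    Cpx n (X.K.X 1) B' where
  K := CochainComplex.of (coneX X.K Y.K) (coneD f) (coneD_comp f)
  isZero_X := by
    rintro (_ | i) hi
    · omega
    · exact (biprod_isZero_iff _ _).2 ⟨X.isZero_X (i + 2) (by omega), Y.isZero_X (i + 1) hi⟩
  left := Iso.refl _
  right :=
    { hom := (biprod.snd : X.K.X (n + 2) ⊞ Y.K.X (n + 1) ⟶ Y.K.X (n + 1)) ≫ Y.right.hom
      inv := Y.right.inv ≫ (biprod.inr : Y.K.X (n + 1) ⟶ X.K.X (n + 2) ⊞ Y.K.X (n + 1))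
      hom_inv_id := by
        change (biprod.snd ≫ Y.right.hom) ≫ Y.right.inv ≫ biprod.inr =
          𝟙 (X.K.X (n + 2) ⊞ Y.K.X (n + 1))
        rw [Category.assoc, Iso.hom_inv_id_assoc]
        apply biprod.hom_ext'
        · exact (X.isZero_X (n + 2) (by omega)).eq_of_src _ _
        · simp
      inv_hom_id := by
        change (Y.right.inv ≫ (biprod.inr : _ ⟶ X.K.X (n + 2) ⊞ Y.K.X (n + 1))) ≫
          biprod.snd ≫ Y.right.hom = 𝟙 B'
        simp }

end Cone

section Truncation

variable [HasZeroObject C]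

/-- The brutal truncation in degrees `≤ m`: the term `Kⁱ` for `i ≤ m`, and `0` for `i > m`. -/
noncomputable def trX (K : CochainComplex C ℕ) (m i : ℕ) : C :=
  if i ≤ m then K.X i else 0

/-- The canonical map from the truncation: the identity for `i ≤ m`, and `0` for `i > m`. -/
noncomputable def trOut (K : CochainComplex C ℕ) (m i : ℕ) : trX K m i ⟶ K.X i :=
  if h : i ≤ m then eqToHom (if_pos h) else 0

/-- The canonical map to the truncation: the identity for `i ≤ m`, and `0` for `i > m`. -/
noncomputable def trIn (K : CochainComplex C ℕ) (m i : ℕ) : K.X i ⟶ trX K m i :=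
  if h : i ≤ m then eqToHom (if_pos h).symm else 0

lemma trIn_trOut (K : CochainComplex C ℕ) {m i : ℕ} (h : i ≤ m) :
    trIn K m i ≫ trOut K m i = 𝟙 _ := by
  rw [trIn, trOut, dif_pos h, dif_pos h]
  exact (eqToHom_trans _ _).trans (eqToHom_refl _ _)

lemma trOut_trIn (K : CochainComplex C ℕ) {m i : ℕ} (h : i ≤ m) :
    trOut K m i ≫ trIn K m i = 𝟙 _ := by
  rw [trIn, trOut, dif_pos h, dif_pos h]
  exact (eqToHom_trans _ _).trans (eqToHom_refl _ _)

lemma isZero_trX (K : CochainComplex C ℕ) {m i : ℕ} (h : m < i) : IsZero (trX K m i) := by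
  rw [trX, if_neg (by omega)]
  exact isZero_zero C

lemma trIn_trOut_comp (K : CochainComplex C ℕ) {m i j : ℕ} (h : i ≤ j) {L : CochainComplex C ℕ}
    (g : K.X i ⟶ L.X j) :
    trIn K m i ≫ trOut K m i ≫ g ≫ trIn L m j = g ≫ trIn L m j := by
  by_cases hj : j ≤ m
  · rw [← Category.assoc, trIn_trOut K (h.trans hj), Category.id_comp]
  · exact (isZero_trX L (by omega)).eq_of_tgt _ _

end Truncation

section Cocone

variable [HasZeroObject C] [HasBinaryBiproducts C]

/-- The terms `X⁰, X¹ ⊞ Y⁰, X² ⊞ Y¹, …` of the mapping cocone, where `Xⁱ` and `Yⁱ` are replaced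
by `0` for `i > n`. -/
noncomputable def coconeX (n : ℕ) (K L : CochainComplex C ℕ) : ℕ → C
  | 0 => K.X 0
  | i + 1 => trX K n (i + 1) ⊞ trX L n i

/-- The differentials of the mapping cocone. -/
noncomputable def coconeD (n : ℕ) {K L : CochainComplex C ℕ} (h : K ⟶ L) :
    ∀ i : ℕ, coconeX n K L i ⟶ coconeX n K L (i + 1)
  | 0 => biprod.lift (K.d 0 1 ≫ trIn K n 1) (h.f 0 ≫ trIn L n 0)
  | i + 1 => biprod.desc
      (biprod.lift (trOut K n (i + 1) ≫ K.d (i + 1) (i + 2) ≫ trIn K n (i + 2))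
        (trOut K n (i + 1) ≫ h.f (i + 1) ≫ trIn L n (i + 1)))
      (biprod.lift 0 (-(trOut L n i ≫ L.d i (i + 1) ≫ trIn L n (i + 1))))

lemma coconeD_comp (n : ℕ) {K L : CochainComplex C ℕ} (h : K ⟶ L) (i : ℕ) :
    coconeD n h i ≫ coconeD n h (i + 1) = 0 := by
  have e1 : ∀ i, trIn K n (i + 1) ≫ trOut K n (i + 1) ≫ K.d (i + 1) (i + 2) ≫ trIn K n (i + 2) =
      K.d (i + 1) (i + 2) ≫ trIn K n (i + 2) := fun i => trIn_trOut_comp K (by omega) _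
  have e2 : ∀ i, trIn K n i ≫ trOut K n i ≫ h.f i ≫ trIn L n i =
      h.f i ≫ trIn L n i := fun i => trIn_trOut_comp K le_rfl _
  have e3 : ∀ i, trIn L n i ≫ trOut L n i ≫ L.d i (i + 1) ≫ trIn L n (i + 1) =
      L.d i (i + 1) ≫ trIn L n (i + 1) := fun i => trIn_trOut_comp L (by omega) _
  cases i with
  | zero =>
    change biprod.lift (K.d 0 1 ≫ trIn K n 1) (h.f 0 ≫ trIn L n 0) ≫
      biprod.desc (biprod.lift (trOut K n 1 ≫ K.d 1 2 ≫ trIn K n 2)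
          (trOut K n 1 ≫ h.f 1 ≫ trIn L n 1))
        (biprod.lift 0 (-(trOut L n 0 ≫ L.d 0 1 ≫ trIn L n 1))) =
      (0 : K.X 0 ⟶ trX K n 2 ⊞ trX L n 1)
    apply biprod.hom_ext
    · have := e1 0
      simp at this
      simp [biprod.lift_desc, this]
    · simp only [biprod.lift_desc, Preadditive.add_comp, Category.assoc, biprod.lift_snd, zero_comp,
        Preadditive.comp_neg]
      rw [e2, e3]
      simp
  | succ i =>
    change biprod.desc
        (biprod.lift (trOut K n (i + 1) ≫ K.d (i + 1) (i + 2) ≫ trIn K n (i + 2))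
          (trOut K n (i + 1) ≫ h.f (i + 1) ≫ trIn L n (i + 1)))
        (biprod.lift 0 (-(trOut L n i ≫ L.d i (i + 1) ≫ trIn L n (i + 1)))) ≫
      biprod.desc
        (biprod.lift (trOut K n (i + 2) ≫ K.d (i + 2) (i + 3) ≫ trIn K n (i + 3))
          (trOut K n (i + 2) ≫ h.f (i + 2) ≫ trIn L n (i + 2)))
        (biprod.lift 0 (-(trOut L n (i + 1) ≫ L.d (i + 1) (i + 2) ≫ trIn L n (i + 2)))) =
      (0 : trX K n (i + 1) ⊞ trX L n i ⟶ trX K n (i + 3) ⊞ trX L n (i + 2))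
    apply biprod.hom_ext' <;> apply biprod.hom_ext
    · simp [e1]
    · simp only [biprod.inl_desc_assoc, biprod.lift_desc, Preadditive.add_comp, Category.assoc,
        biprod.lift_snd, zero_comp, Preadditive.comp_neg, comp_zero]
      rw [e2, e3]
      simp
    · simp
    · simp [e3]

/-- The mapping cocone `X⁰ ⟶ X¹ ⊞ Y⁰ ⟶ ⋯ ⟶ Xⁿ ⊞ Yⁿ⁻¹ ⟶ Yⁿ` of a morphism `h : X ⟶ Y` (used for
`hⁿ⁺¹ = 𝟙`), dual to the mapping cone. Its term of degree `n + 1` is literally `0 ⊞ Yⁿ`. -/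
noncomputable def cocone {A B A' B' : C} {X : Cpx n A B} {Y : Cpx n A' B'} (h : X.K ⟶ Y.K) :
    Cpx n A (Y.K.X n) where
  K := CochainComplex.of (coconeX n X.K Y.K) (coconeD n h) (coconeD_comp n h)
  isZero_X := by
    rintro (_ | i) hi
    · omega
    · exact (biprod_isZero_iff _ _).2 ⟨isZero_trX _ (by omega), isZero_trX _ (by omega)⟩
  left := X.left
  right :=
    { hom := (biprod.snd : trX X.K n (n + 1) ⊞ trX Y.K n n ⟶ trX Y.K n n) ≫ trOut Y.K n n
      inv := trIn Y.K n n ≫ (biprod.inr : trX Y.K n n ⟶ trX X.K n (n + 1) ⊞ trX Y.K n n)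
      hom_inv_id := by
        change (biprod.snd ≫ trOut Y.K n n) ≫ trIn Y.K n n ≫ biprod.inr =
          𝟙 (trX X.K n (n + 1) ⊞ trX Y.K n n)
        rw [Category.assoc, ← Category.assoc (trOut _ _ _), trOut_trIn _ le_rfl, Category.id_comp]
        apply biprod.hom_ext'
        · exact (isZero_trX X.K (by omega)).eq_of_src _ _
        · simp
      inv_hom_id := by
        change (trIn Y.K n n ≫ (biprod.inr : _ ⟶ trX X.K n (n + 1) ⊞ trX Y.K n n)) ≫
          biprod.snd ≫ trOut Y.K n n = 𝟙 (Y.K.X n)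
        simp [trIn_trOut] }

end Cocone

end Cpx

end Complexes

section Extensions

variable {C : Type u} [Category.{v} C] [Preadditive C]

/-- The group `𝔼(B, A)` of extensions. -/
abbrev ExtGrp (E : Cᵒᵖ ⥤ C ⥤ AddCommGrpCat.{w}) (B A : C) : Type w := (E.obj (op B)).obj A

/-- `a_* δ` -/
def push {E : Cᵒᵖ ⥤ C ⥤ AddCommGrpCat.{w}} {B A A' : C} (a : A ⟶ A') (δ : ExtGrp E B A) :
    ExtGrp E B A' := ((E.obj (op B)).map a).hom δ

/-- `c^* δ` -/
def pull {E : Cᵒᵖ ⥤ C ⥤ AddCommGrpCat.{w}} {B B' A : C} (c : B' ⟶ B) (δ : ExtGrp E B A) :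
    ExtGrp E B' A := ((E.map c.op).app A).hom δ

/-- The direct sum `δ ⊕ ρ` of two extensions. -/
noncomputable def extSum {E : Cᵒᵖ ⥤ C ⥤ AddCommGrpCat.{w}} [HasBinaryBiproducts C]
    {A B A' B' : C} (δ : ExtGrp E B A) (ρ : ExtGrp E B' A') : ExtGrp E (B ⊞ B') (A ⊞ A') :=
  push biprod.inl (pull biprod.fst δ) + push biprod.inr (pull biprod.snd ρ)

/-- `⟨X, δ⟩` is an `n`-exangle: the sequences of functors
`C(-, X⁰) ⟶ ⋯ ⟶ C(-, Xⁿ⁺¹) ⟶ 𝔼(-, X⁰)` and `C(Xⁿ⁺¹, -) ⟶ ⋯ ⟶ C(X⁰, -) ⟶ 𝔼(Xⁿ⁺¹, -)` are exact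
(at all inner terms). -/
structure IsExangle {E : Cᵒᵖ ⥤ C ⥤ AddCommGrpCat.{w}} {n : ℕ} {A B : C} (X : Cpx n A B)
    (δ : ExtGrp E B A) : Prop where
  contra_mid : ∀ i : ℕ, i + 1 ≤ n → ∀ (T : C) (g : T ⟶ X.K.X (i + 1)),
    g ≫ X.K.d (i + 1) (i + 2) = 0 → ∃ h : T ⟶ X.K.X i, h ≫ X.K.d i (i + 1) = g
  contra_end : ∀ (T : C) (g : T ⟶ B), pull g δ = 0 ↔ ∃ h : T ⟶ X.K.X n, h ≫ X.dLast = g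
  co_mid : ∀ i : ℕ, i + 1 ≤ n → ∀ (T : C) (g : X.K.X (i + 1) ⟶ T),
    X.K.d i (i + 1) ≫ g = 0 → ∃ h : X.K.X (i + 2) ⟶ T, X.K.d (i + 1) (i + 2) ≫ h = g
  co_end : ∀ (T : C) (g : A ⟶ T), push g δ = 0 ↔ ∃ h : X.K.X 1 ⟶ T, X.dFirst ≫ h = g

/-- A correspondence `𝔰` assigning to each extension `δ ∈ 𝔼(B, A)` a homotopy equivalence class
`𝔰(δ)` of complexes from `A` to `B`. -/
abbrev Correspondence (E : Cᵒᵖ ⥤ C ⥤ AddCommGrpCat.{w}) (n : ℕ) :=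
  ∀ ⦃A B : C⦄, ExtGrp E B A → HClass n A B

variable {E : Cᵒᵖ ⥤ C ⥤ AddCommGrpCat.{w}} {n : ℕ}

/-- `𝔰(δ) = [X]`. -/
def Realizes (s : Correspondence E n) {A B : C} (X : Cpx n A B) (δ : ExtGrp E B A) : Prop :=
  s δ = Quotient.mk _ X

/-- `f` is an inflation: it is the first differential of a conflation `X`. (The second term of `X`
is identified with the target of `f`.) -/
def IsInflation (s : Correspondence E n) {A A' : C} (f : A ⟶ A') : Prop :=
  ∃ (B : C) (X : Cpx n A B) (δ : ExtGrp E B A) (φ : X.K.X 1 ≅ A'),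
    Realizes s X δ ∧ X.dFirst ≫ φ.hom = f

/-- `g` is a deflation: it is the last differential of a conflation `X`. -/
def IsDeflation (s : Correspondence E n) {B' B : C} (g : B' ⟶ B) : Prop :=
  ∃ (A : C) (X : Cpx n A B) (δ : ExtGrp E B A) (φ : B' ≅ X.K.X n),
    Realizes s X δ ∧ φ.hom ≫ X.dLast = g

/-- `𝔰` is an exact realization of `𝔼`. -/
structure IsExactRealization (s : Correspondence E n) : Prop where
  /-- (R0) -/
  exists_lift : ∀ {A B A' B' : C} (X : Cpx n A B) (δ : ExtGrp E B A) (Y : Cpx n A' B')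
    (ρ : ExtGrp E B' A'), Realizes s X δ → Realizes s Y ρ → ∀ (a : A ⟶ A') (c : B ⟶ B'),
    push a δ = pull c ρ → ∃ f : X.K ⟶ Y.K, Cpx.IsLift (X := X) (Y := Y) f a c
  /-- (R1) -/
  isExangle : ∀ {A B : C} (X : Cpx n A B) (δ : ExtGrp E B A), Realizes s X δ → IsExangle X δ
  /-- (R2): the complexes `A ≅ A ⟶ 0 ⟶ ⋯ ⟶ 0` realize the zero element of `𝔼(0, A)` -/
  realizes_zero : ∀ {A Z : C} (X : Cpx n A Z), IsIso (X.K.d 0 1) →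
    (∀ i, 2 ≤ i → IsZero (X.K.X i)) → Realizes s X (0 : ExtGrp E Z A)
  /-- (R2), dually: the complexes `0 ⟶ ⋯ ⟶ 0 ⟶ A ≅ A` realize the zero element of `𝔼(A, 0)` -/
  realizes_zero' : ∀ {A Z : C} (X : Cpx n Z A), IsIso (X.K.d n (n + 1)) →
    (∀ i, i < n → IsZero (X.K.X i)) → Realizes s X (0 : ExtGrp E A Z)

/-- `(C, 𝔼, 𝔰)` is an `n`-exangulated category (`C` additive, `𝔼` an additive bifunctor). -/
structure IsNExangulated [HasZeroObject C] [HasBinaryBiproducts C] (s : Correspondence E n) : Prop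
    extends IsExactRealization s where
  /-- (EA1) -/
  inflation_comp : ∀ {A B D : C} (f : A ⟶ B) (g : B ⟶ D),
    IsInflation s f → IsInflation s g → IsInflation s (f ≫ g)
  deflation_comp : ∀ {A B D : C} (f : A ⟶ B) (g : B ⟶ D),
    IsDeflation s f → IsDeflation s g → IsDeflation s (f ≫ g)
  /-- (EA2) -/
  good_lift : ∀ {A B D : C} (ρ : ExtGrp E D A) (c : B ⟶ D) (X : Cpx n A B) (Y : Cpx n A D),
    Realizes s X (pull c ρ) → Realizes s Y ρ →
    ∃ f : X.K ⟶ Y.K, Cpx.IsLift (X := X) (Y := Y) f (𝟙 A) c ∧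
      Realizes s (Cpx.cone (X := X) (Y := Y) f) (push X.dFirst ρ)
  /-- (EA2ᵒᵖ) -/
  good_lift' : ∀ {A A' B : C} (δ : ExtGrp E B A) (a : A ⟶ A') (X : Cpx n A B) (Y : Cpx n A' B),
    Realizes s X δ → Realizes s Y (push a δ) →
    ∃ h : X.K ⟶ Y.K, Cpx.IsLift (X := X) (Y := Y) h a (𝟙 B) ∧
      Realizes s (Cpx.cocone (X := X) (Y := Y) h) (pull Y.dLast δ)

/-- A pair `⟨X, δ⟩` of a complex `X` from `A` to `B` and an extension `δ ∈ 𝔼(B, A)`. -/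
structure NPair (E : Cᵒᵖ ⥤ C ⥤ AddCommGrpCat.{w}) (n : ℕ) where
  A : C
  B : C
  X : Cpx n A B
  δ : ExtGrp E B A

/-- `ξ` is an `n`-proper class of distinguished `n`-exangles in `(C, 𝔼, 𝔰)`. -/
structure IsNProperClass [HasBinaryBiproducts C] (s : Correspondence E n) (ξ : Set (NPair E n)) :
    Prop where
  /-- `ξ` consists of distinguished `n`-exangles -/
  distinguished : ∀ P ∈ ξ, Realizes s P.X P.δ
  /-- `ξ` is closed under weak isomorphisms, that is, morphisms of distinguished `n`-exangles
  whose components on the end terms are isomorphisms -/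
  weak_iso : ∀ P Q : NPair E n, Realizes s P.X P.δ → Realizes s Q.X Q.δ →
    ∀ (f : P.X.K ⟶ Q.X.K) (a : P.A ≅ Q.A) (c : P.B ≅ Q.B),
      Cpx.IsLift (X := P.X) (Y := Q.X) f a.hom c.hom → push a.hom P.δ = pull c.hom Q.δ →
      (P ∈ ξ ↔ Q ∈ ξ)
  /-- `ξ` contains all split distinguished `n`-exangles -/
  split : ∀ P : NPair E n, Realizes s P.X P.δ → P.δ = 0 → P ∈ ξ
  /-- `ξ` is closed under finite coproducts -/
  sum : ∀ P ∈ ξ, ∀ Q ∈ ξ, (⟨_, _, P.X.sum Q.X, extSum P.δ Q.δ⟩ : NPair E n) ∈ ξ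
  /-- `ξ` is closed under base change -/
  base_change : ∀ P ∈ ξ, ∀ {B' : C} (c : B' ⟶ P.B) (Y : Cpx n P.A B'),
    Realizes s Y (pull c P.δ) → (⟨_, _, Y, pull c P.δ⟩ : NPair E n) ∈ ξ
  /-- `ξ` is closed under cobase change -/
  cobase_change : ∀ P ∈ ξ, ∀ {A' : C} (a : P.A ⟶ A') (Y : Cpx n A' P.B),
    Realizes s Y (push a P.δ) → (⟨_, _, Y, push a P.δ⟩ : NPair E n) ∈ ξ
  /-- `ξ` is saturated: if `⟨Y, ρ⟩ ∈ ξ` and `⟨X, δ⟩` are distinguished with the same last term,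
  and the base change of `⟨X, δ⟩` along the last differential of `Y` is in `ξ`, then so is
  `⟨X, δ⟩` -/
  saturated : ∀ {A A' B : C} (X : Cpx n A B) (δ : ExtGrp E B A) (Y : Cpx n A' B)
    (ρ : ExtGrp E B A') (M : Cpx n A (Y.K.X n)), Realizes s X δ →
    (⟨_, _, Y, ρ⟩ : NPair E n) ∈ ξ → (⟨_, _, M, pull Y.dLast δ⟩ : NPair E n) ∈ ξ →
    (⟨_, _, X, δ⟩ : NPair E n) ∈ ξ

/-- `𝔽` is a closed (additive) subbifunctor of `𝔼`; `𝔽 B A` is the subgroup `𝔽(B, A)` of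
`𝔼(B, A)`. -/
structure IsClosedSubbifunctor (s : Correspondence E n)
    (F : ∀ B A : C, AddSubgroup (ExtGrp E B A)) : Prop where
  push_mem : ∀ {B A A' : C} (a : A ⟶ A') (δ : ExtGrp E B A), δ ∈ F B A → push a δ ∈ F B A'
  pull_mem : ∀ {B B' A : C} (c : B' ⟶ B) (δ : ExtGrp E B A), δ ∈ F B A → pull c δ ∈ F B' A
  /-- closed on the right: `𝔽(-, X⁰) ⟶ 𝔽(-, X¹) ⟶ 𝔽(-, X²)` is exact for all conflations `X`
  that realize an element of `𝔽` -/
  closed_right : ∀ {A B : C} (X : Cpx n A B) (δ : ExtGrp E B A), δ ∈ F B A → Realizes s X δ →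
    ∀ (T : C), ∀ θ ∈ F T (X.K.X 1), push (X.K.d 1 2) θ = 0 ↔ ∃ η ∈ F T A, push X.dFirst η = θ
  /-- closed on the left: `𝔽(Xⁿ⁺¹, -) ⟶ 𝔽(Xⁿ, -) ⟶ 𝔽(Xⁿ⁻¹, -)` is exact for all conflations `X`
  that realize an element of `𝔽` -/
  closed_left : ∀ {A B : C} (X : Cpx n A B) (δ : ExtGrp E B A), δ ∈ F B A → Realizes s X δ →
    ∀ (T : C), ∀ θ ∈ F (X.K.X n) T,
      pull (X.K.d (n - 1) n) θ = 0 ↔ ∃ η ∈ F B T, pull X.dLast η = θ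

/-- The contravariant defect of a pair `⟨X, δ⟩`: the cokernel of `C(-, Xⁿ) ⟶ C(-, Xⁿ⁺¹)` in the
category of contravariant functors from `C` to abelian groups. -/
noncomputable def defect {A B : C} (X : Cpx n A B) : Cᵒᵖ ⥤ AddCommGrpCat.{v} :=
  cokernel (preadditiveYoneda.map X.dLast)

/-- `def 𝔽`: the functors that are isomorphic to the contravariant defect of a distinguished
`n`-exangle `⟨X, δ⟩` with `δ` in `𝔽`. (Such functors are finitely presented.) -/
def defOf (s : Correspondence E n) (F : ∀ B A : C, AddSubgroup (ExtGrp E B A)) :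
    ObjectProperty (Cᵒᵖ ⥤ AddCommGrpCat.{v}) := fun G =>
  ∃ (A B : C) (X : Cpx n A B) (δ : ExtGrp E B A),
    δ ∈ F B A ∧ Realizes s X δ ∧ Nonempty (G ≅ defect X)

/-- `def 𝔼`. -/
def defE (s : Correspondence E n) : ObjectProperty (Cᵒᵖ ⥤ AddCommGrpCat.{v}) :=
  defOf s fun _ _ => ⊤

end Extensions

/-- A Serre subcategory of a category `D` (here always an abelian one): a full subcategory that
contains a zero object and is closed under subobjects, quotients and extensions in `D`. -/
structure IsSerreSubcategory {D : Type u} [Category.{v} D] [HasZeroMorphisms D]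
    (S : ObjectProperty D) : Prop where
  containsZero : S.ContainsZero
  subobjects : S.IsClosedUnderSubobjects
  quotients : S.IsClosedUnderQuotients
  extensions : S.IsClosedUnderExtensions

end NEx

set_option linter.unusedSectionVars false

/-! By the exangle axioms the contravariant defect of a distinguished `⟨X, δ⟩` is the image of `C(-,
B) ⟶ 𝔼(-, A)`: the class of `u : T ⟶ B` is recorded by `u^*δ`. Questions about defects thereby
become identities between extensions. A morphism from the defect of `δ` to that of `ρ` comes from
some `c` with `c^*ρ = a_*δ` for a suitable `a`. If it is mono, then `δ = b_* c^*ρ` for some `b`; if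
it is epi, then `ρ = t^* a_*δ` for some `t`. So a family of subgroups stable under `a_*` and `c^*`
depends only on the isomorphism classes of the defects, and these are stable under subobjects and
quotients.

The one remaining condition is saturation (`IsSaturatedSubbifunctor`), the pivot of both bijections.
It is an axiom for `n`-proper classes. For subbifunctors it is equivalent to closedness
(`IsSaturatedSubbifunctor.isClosed`, `IsClosedSubbifunctor.isSaturated`). For defects it matches
closure under extensions (`IsClosedSubbifunctor.mem_of_exact`,
`IsSerreSubcategory.prop_defObj_of_pull`).

Two ingredients carry this. The first is the continuation of the long exact sequences past the
connecting maps into `𝔼`: `exists_pull_of_push_eq_zero`, `exists_push_of_pull_eq_zero`,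
`exists_push_dFirst`, `exists_pull_dLast`. The second is that monomorphisms, epimorphisms and
exactness in the full subcategory `def 𝔼` can be tested on elements, because the subfunctor
generated by an element of a defect and the cokernel of a morphism of defects are again defects. -/

namespace NEx

/-! ### Calculus of `a_*` and `c^*` -/

section ExtensionCalculus

variable {C : Type u} [Category.{v} C] [Preadditive C] {E : Cᵒᵖ ⥤ C ⥤ AddCommGrpCat.{w}}

@[simp] lemma push_id {B A : C} (δ : ExtGrp E B A) : push (𝟙 A) δ = δ := by simp [push]

@[simp] lemma pull_id {B A : C} (δ : ExtGrp E B A) : pull (𝟙 B) δ = δ := by simp [pull]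

lemma push_comp {B A A' A'' : C} (a : A ⟶ A') (a' : A' ⟶ A'') (δ : ExtGrp E B A) :
    push (a ≫ a') δ = push a' (push a δ) := by simp [push]

lemma pull_comp {B B' B'' A : C} (c : B'' ⟶ B') (c' : B' ⟶ B) (δ : ExtGrp E B A) :
    pull (c ≫ c') δ = pull c (pull c' δ) := by simp [pull]

@[simp] lemma push_zero {B A A' : C} (a : A ⟶ A') : push a (0 : ExtGrp E B A) = 0 := by
  simp [push]

@[simp] lemma pull_zero {B B' A : C} (c : B' ⟶ B) : pull c (0 : ExtGrp E B A) = 0 := by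
  simp [pull]

lemma push_add {B A A' : C} (a : A ⟶ A') (δ ρ : ExtGrp E B A) :
    push a (δ + ρ) = push a δ + push a ρ := by simp [push]

lemma pull_add {B B' A : C} (c : B' ⟶ B) (δ ρ : ExtGrp E B A) :
    pull c (δ + ρ) = pull c δ + pull c ρ := by simp [pull]

lemma pull_sub {B B' A : C} (c : B' ⟶ B) (δ ρ : ExtGrp E B A) :
    pull c (δ - ρ) = pull c δ - pull c ρ := by simp [pull]

lemma pull_push {B B' A A' : C} (c : B' ⟶ B) (a : A ⟶ A') (δ : ExtGrp E B A) :
    pull c (push a δ) = push a (pull c δ) := by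
  have := congr($((E.map c.op).naturality a).hom δ)
  exact this

lemma add_push [∀ B : Cᵒᵖ, (E.obj B).Additive] {B A A' : C} (a b : A ⟶ A') (δ : ExtGrp E B A) :
    push (a + b) δ = push a δ + push b δ := by
  simp [push, Functor.map_add]

lemma add_pull [E.Additive] {B B' A : C} (c d : B' ⟶ B) (δ : ExtGrp E B A) :
    pull (c + d) δ = pull c δ + pull d δ := by
  simp [pull, Functor.map_add]

@[simp] lemma zero_push [∀ B : Cᵒᵖ, (E.obj B).Additive] {B A A' : C} (δ : ExtGrp E B A) :
    push (0 : A ⟶ A') δ = 0 := by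
  simp [push]

@[simp] lemma zero_pull [E.Additive] {B B' A : C} (δ : ExtGrp E B A) : pull (0 : B' ⟶ B) δ = 0 := by
  simp [pull]

lemma neg_pull [E.Additive] {B B' A : C} (c : B' ⟶ B) (δ : ExtGrp E B A) :
    pull (-c) δ = -pull c δ := by
  rw [eq_neg_iff_add_eq_zero, ← add_pull, neg_add_cancel, zero_pull]

end ExtensionCalculus

end NEx

/-! ### Mapping cones and the long exact sequences of `𝔼` -/

namespace NEx

variable {C : Type u} [Category.{v} C] [Preadditive C] {E : Cᵒᵖ ⥤ C ⥤ AddCommGrpCat.{w}} {n : ℕ}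
  {s : Correspondence E n}

section

variable [HasBinaryBiproducts C]

lemma lift_comp_eq {A P Q R : C} (a : A ⟶ P) (b : A ⟶ Q) (r : P ⊞ Q ⟶ R) :
    biprod.lift a b ≫ r = a ≫ biprod.inl ≫ r + b ≫ biprod.inr ≫ r := by
  simp [biprod.lift_eq]

lemma comp_desc_eq {A P Q R : C} (r : R ⟶ P ⊞ Q) (a : P ⟶ A) (b : Q ⟶ A) :
    r ≫ biprod.desc a b = (r ≫ biprod.fst) ≫ a + (r ≫ biprod.snd) ≫ b := by
  simp [biprod.desc_eq]

lemma dFirst_comp_d {A B : C} (X : Cpx n A B) : X.dFirst ≫ X.K.d 1 2 = 0 := by simp [Cpx.dFirst]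

lemma d_comp_dLast {A B : C} (X : Cpx n A B) {i : ℕ} : X.K.d i n ≫ X.dLast = 0 := by
  simp [Cpx.dLast]

lemma exists_realizes (s : Correspondence E n) {A B : C} (δ : ExtGrp E B A) :
    ∃ X : Cpx n A B, Realizes s X δ := by
  obtain ⟨X, hX⟩ := Quotient.exists_rep (s δ)
  exact ⟨X, hX.symm⟩

namespace Cpx.IsLift

variable {A B A' B' : C} {X : Cpx n A B} {Y : Cpx n A' B'} {f : X.K ⟶ Y.K} {a : A ⟶ A'} {c : B ⟶ B'}

lemma dFirst_comm (h : IsLift (X := X) (Y := Y) f a c) :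
    X.dFirst ≫ f.f 1 = a ≫ Y.dFirst := by
  have h1 : X.left.inv ≫ f.f 0 = a ≫ Y.left.inv := by
    rw [Iso.inv_comp_eq, ← Category.assoc, ← h.1, Category.assoc, Iso.hom_inv_id, Category.comp_id]
  rw [Cpx.dFirst, Cpx.dFirst, Category.assoc, ← f.comm, ← Category.assoc, h1, Category.assoc]

lemma dLast_comm (h : IsLift (X := X) (Y := Y) f a c) :
    f.f n ≫ Y.dLast = X.dLast ≫ c := by
  rw [Cpx.dLast, Cpx.dLast, Category.assoc, ← h.2, ← Category.assoc, f.comm, Category.assoc]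

end Cpx.IsLift

namespace IsExangle

variable {A B : C} {X : Cpx n A B} {δ : ExtGrp E B A}

lemma pull_dLast (h : IsExangle X δ) : pull X.dLast δ = 0 :=
  (h.contra_end _ _).2 ⟨𝟙 _, by simp⟩

lemma push_dFirst (h : IsExangle X δ) : push X.dFirst δ = 0 :=
  (h.co_end _ _).2 ⟨𝟙 _, by simp⟩

lemma exists_section (h : IsExangle X δ) (hδ : δ = 0) : ∃ t : B ⟶ X.K.X n, t ≫ X.dLast = 𝟙 B :=
  (h.contra_end _ _).1 (by simp [hδ])

lemma exists_retraction (h : IsExangle X δ) (hδ : δ = 0) :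
    ∃ r : X.K.X 1 ⟶ A, X.dFirst ≫ r = 𝟙 A :=
  (h.co_end _ _).1 (by simp [hδ])

lemma exists_of_dFirst_comp (h : IsExangle X δ) (hn : 1 ≤ n) {T : C} (g : X.K.X 1 ⟶ T)
    (hg : X.dFirst ≫ g = 0) : ∃ k : X.K.X 2 ⟶ T, X.K.d 1 2 ≫ k = g := by
  refine h.co_mid 0 (by omega) T g ?_
  rwa [Cpx.dFirst, Category.assoc, Iso.inv_comp_eq, comp_zero] at hg

lemma exists_of_comp_dLast {m : ℕ} {X : Cpx (m + 1) A B} (h : IsExangle X δ) {T : C}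
    (g : T ⟶ X.K.X (m + 1)) (hg : g ≫ X.dLast = 0) :
    ∃ k : T ⟶ X.K.X m, k ≫ X.K.d m (m + 1) = g := by
  refine h.contra_mid m le_rfl T g ?_
  rwa [Cpx.dLast, ← Category.assoc, ← Iso.eq_comp_inv, zero_comp] at hg

end IsExangle

end

variable [HasZeroObject C] [HasBinaryBiproducts C]

section Cone

lemma cone_d {A B A' B' : C} {X : Cpx n A B} {Y : Cpx n A' B'} (f : X.K ⟶ Y.K) (i : ℕ) :
    (Cpx.cone (X := X) (Y := Y) f).K.d i (i + 1) = Cpx.coneD f i :=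
  CochainComplex.of_d _ _ _

lemma cocone_d {A B A' B' : C} {X : Cpx n A B} {Y : Cpx n A' B'} (f : X.K ⟶ Y.K) (i : ℕ) :
    (Cpx.cocone (X := X) (Y := Y) f).K.d i (i + 1) = Cpx.coconeD n f i :=
  CochainComplex.of_d _ _ _

lemma cone_dFirst {A B A' B' : C} {X : Cpx n A B} {Y : Cpx n A' B'} (f : X.K ⟶ Y.K) :
    (Cpx.cone (X := X) (Y := Y) f).dFirst =
      (biprod.lift (-X.K.d 1 2) (f.f 1) : X.K.X 1 ⟶ X.K.X 2 ⊞ Y.K.X 1) := by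
  rw [Cpx.dFirst, cone_d]
  exact Category.id_comp _

/-- With `n = m + 1` the term of degree `n` of the cone reduces definitionally to a biproduct. -/
lemma cone_dLast {m : ℕ} {A B A' B' : C} {X : Cpx (m + 1) A B} {Y : Cpx (m + 1) A' B'}
    (f : X.K ⟶ Y.K) (c : B ⟶ B') (hf : f.f (m + 2) ≫ Y.right.hom = X.right.hom ≫ c) :
    (Cpx.cone (X := X) (Y := Y) f).dLast =
      (biprod.desc (X.right.hom ≫ c) Y.dLast : X.K.X (m + 2) ⊞ Y.K.X (m + 1) ⟶ B') := by
  rw [Cpx.dLast, cone_d]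
  change (biprod.desc (biprod.lift (-X.K.d (m + 2) (m + 3)) (f.f (m + 2)))
      (biprod.lift 0 (Y.K.d (m + 1) (m + 2)))) ≫ biprod.snd ≫ Y.right.hom = _
  apply biprod.hom_ext' <;> simp [Cpx.dLast, hf]

lemma cocone_dFirst {A B A' B' : C} {X : Cpx n A B} {Y : Cpx n A' B'} (f : X.K ⟶ Y.K)
    (a : A ⟶ A') (hf : f.f 0 ≫ Y.left.hom = X.left.hom ≫ a) :
    (Cpx.cocone (X := X) (Y := Y) f).dFirst =
      (biprod.lift (X.dFirst ≫ Cpx.trIn X.K n 1) (a ≫ Y.left.inv ≫ Cpx.trIn Y.K n 0) :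
        A ⟶ Cpx.trX X.K n 1 ⊞ Cpx.trX Y.K n 0) := by
  rw [Cpx.dFirst, cocone_d]
  change X.left.inv ≫ biprod.lift (X.K.d 0 1 ≫ Cpx.trIn X.K n 1) (f.f 0 ≫ Cpx.trIn Y.K n 0) = _
  have h1 : X.left.inv ≫ f.f 0 = a ≫ Y.left.inv := by
    rw [Iso.inv_comp_eq, ← Category.assoc, ← hf, Category.assoc, Iso.hom_inv_id, Category.comp_id]
  have h2 := congr($h1 ≫ Cpx.trIn Y.K n 0)
  simp only [Category.assoc] at h2
  apply biprod.hom_ext <;> simp [Cpx.dFirst, h2]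

lemma cocone_dLast {m : ℕ} {A B A' B' : C} {X : Cpx (m + 1) A B} {Y : Cpx (m + 1) A' B'}
    (f : X.K ⟶ Y.K) :
    (Cpx.cocone (X := X) (Y := Y) f).dLast =
      (biprod.desc (Cpx.trOut X.K (m + 1) (m + 1) ≫ f.f (m + 1))
        (-(Cpx.trOut Y.K (m + 1) m ≫ Y.K.d m (m + 1))) :
        Cpx.trX X.K (m + 1) (m + 1) ⊞ Cpx.trX Y.K (m + 1) m ⟶ Y.K.X (m + 1)) := by
  rw [Cpx.dLast, cocone_d]
  change (biprod.desc
      (biprod.lift (Cpx.trOut X.K (m + 1) (m + 1) ≫ X.K.d (m + 1) (m + 2) ≫ Cpx.trIn X.K (m + 1) (m + 2))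
        (Cpx.trOut X.K (m + 1) (m + 1) ≫ f.f (m + 1) ≫ Cpx.trIn Y.K (m + 1) (m + 1)))
      (biprod.lift 0 (-(Cpx.trOut Y.K (m + 1) m ≫ Y.K.d m (m + 1) ≫ Cpx.trIn Y.K (m + 1) (m + 1))))) ≫
      biprod.snd ≫ Cpx.trOut Y.K (m + 1) (m + 1) = _
  apply biprod.hom_ext' <;> simp [Cpx.trIn_trOut]

end Cone

variable [E.Additive] [∀ B : Cᵒᵖ, (E.obj B).Additive]

namespace IsNExangulated

/-- Exactness of `C(T, B) ⟶ 𝔼(T, A) ⟶ 𝔼(T, X¹)`. The extensions `η` and `δ` are glued to one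
extension `ζ` over `T ⊞ B`. A good lift along `B ⟶ T ⊞ B` has a cone realizing `dFirst_* ζ = 0`, so
the last map of the cone splits, and the splitting writes `ζ` as a base change of `δ`. -/
lemma exists_pull_of_push_eq_zero (hs : IsNExangulated s) (hn : 1 ≤ n) {A B : C} {X : Cpx n A B}
    {δ : ExtGrp E B A} (hX : Realizes s X δ) {T : C} (η : ExtGrp E T A)
    (hη : push X.dFirst η = 0) : ∃ t : T ⟶ B, pull t δ = η := by
  obtain ⟨m, rfl⟩ : ∃ m, n = m + 1 := ⟨n - 1, by omega⟩
  let ζ : ExtGrp E (T ⊞ B) A := pull biprod.fst η + pull biprod.snd δ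
  have hinr : pull biprod.inr ζ = δ := by
    simp [ζ, pull_add, ← pull_comp]
  have hinl : pull biprod.inl ζ = η := by
    simp [ζ, pull_add, ← pull_comp]
  obtain ⟨Z, hZ⟩ := exists_realizes s ζ
  obtain ⟨f, hf, hcone⟩ := hs.good_lift ζ biprod.inr X Z (by rwa [hinr]) hZ
  have h0 : push X.dFirst ζ = 0 := by
    simp [ζ, push_add, ← pull_push, hη, (hs.isExangle X δ hX).push_dFirst]
  obtain ⟨r, hr⟩ := (hs.isExangle _ _ hcone).exists_section h0
  rw [cone_dLast f biprod.inr hf.2] at hr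
  change T ⊞ B ⟶ X.K.X (m + 2) ⊞ Z.K.X (m + 1) at r
  have hr' : (r ≫ biprod.fst ≫ X.right.hom) ≫ biprod.inr + (r ≫ biprod.snd) ≫ Z.dLast =
      𝟙 (T ⊞ B) := by
    have e := comp_desc_eq r (X.right.hom ≫ biprod.inr) Z.dLast
    replace e := e.symm.trans hr
    simpa only [Category.assoc] using e
  refine ⟨biprod.inl ≫ r ≫ biprod.fst ≫ X.right.hom, ?_⟩
  -- The splitting decomposes `𝟙` into a part through `B` and a part through `Z.dLast`; the latter
  -- kills `ζ`.
  have h1 : pull (𝟙 (T ⊞ B)) ζ = pull (r ≫ biprod.fst ≫ X.right.hom) δ := by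
    rw [← hr', add_pull, pull_comp, hinr, pull_comp _ Z.dLast,
      (hs.isExangle _ _ hZ).pull_dLast, pull_zero, add_zero]
  rw [pull_comp, ← h1, pull_id, hinl]

/-- Exactness of `C(A, T) ⟶ 𝔼(B, T) ⟶ 𝔼(Xⁿ, T)`, by the dual argument with the cocone. -/
lemma exists_push_of_pull_eq_zero (hs : IsNExangulated s) {A B : C} {X : Cpx n A B}
    {δ : ExtGrp E B A} (hX : Realizes s X δ) {T : C} (θ : ExtGrp E B T)
    (hθ : pull X.dLast θ = 0) : ∃ a : A ⟶ T, push a δ = θ := by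
  let ζ : ExtGrp E B (T ⊞ A) := push biprod.inl θ + push biprod.inr δ
  have hsnd : push biprod.snd ζ = δ := by
    simp [ζ, push_add, ← push_comp]
  have hfst : push biprod.fst ζ = θ := by
    simp [ζ, push_add, ← push_comp]
  obtain ⟨Z, hZ⟩ := exists_realizes s ζ
  obtain ⟨f, hf, hcone⟩ := hs.good_lift' ζ biprod.snd Z X hZ (by rwa [hsnd])
  have h0 : pull X.dLast ζ = 0 := by
    simp [ζ, pull_add, pull_push, hθ, (hs.isExangle X δ hX).pull_dLast]
  obtain ⟨r, hr⟩ := (hs.isExangle _ _ hcone).exists_retraction h0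
  rw [cocone_dFirst f biprod.snd hf.1] at hr
  change Cpx.trX Z.K n 1 ⊞ Cpx.trX X.K n 0 ⟶ T ⊞ A at r
  have hr' : Z.dFirst ≫ (Cpx.trIn Z.K n 1 ≫ biprod.inl ≫ r) +
      biprod.snd ≫ (X.left.inv ≫ Cpx.trIn X.K n 0 ≫ biprod.inr ≫ r) = 𝟙 (T ⊞ A) := by
    have e := lift_comp_eq (Z.dFirst ≫ Cpx.trIn Z.K n 1)
      (biprod.snd ≫ X.left.inv ≫ Cpx.trIn X.K n 0) r
    replace e := e.symm.trans hr
    simpa only [Category.assoc] using e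
  refine ⟨(X.left.inv ≫ Cpx.trIn X.K n 0 ≫ biprod.inr ≫ r) ≫ biprod.fst, ?_⟩
  have h1 : push (𝟙 (T ⊞ A)) ζ = push (X.left.inv ≫ Cpx.trIn X.K n 0 ≫ biprod.inr ≫ r) δ := by
    rw [← hr', add_push, push_comp, (hs.isExangle _ _ hZ).push_dFirst, push_zero, zero_add,
      push_comp, hsnd]
  rw [push_comp, ← h1, push_id, hfst]

/-- Exactness of `𝔼(T, A) ⟶ 𝔼(T, X¹) ⟶ 𝔼(T, X²)`. With `Y` realizing `θ`, the composite of the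
inflations of `X` and `Y` is the inflation of some `⟨Z, ζ⟩`, and `δ = c^*ζ`. A good lift `X ⟶ Z` has
a cone realizing `dFirst_* ζ` whose inflation kills `θ`; hence `θ = t^* dFirst_* ζ = dFirst_* t^*ζ`.
-/
lemma exists_push_dFirst (hs : IsNExangulated s) (hn : 1 ≤ n) {A B : C} {X : Cpx n A B}
    {δ : ExtGrp E B A} (hX : Realizes s X δ) {T : C} (θ : ExtGrp E T (X.K.X 1))
    (hθ : push (X.K.d 1 2) θ = 0) : ∃ η : ExtGrp E T A, push X.dFirst η = θ := by
  have eX := hs.isExangle _ _ hX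
  obtain ⟨Y, hY⟩ := exists_realizes s θ
  have eY := hs.isExangle _ _ hY
  obtain ⟨D, Z, ζ, φ, hZ, hφ⟩ := hs.inflation_comp X.dFirst Y.dFirst
    ⟨_, X, δ, Iso.refl _, hX, by simp⟩ ⟨_, Y, θ, Iso.refl _, hY, by simp⟩
  have hφ' : Z.dFirst = X.dFirst ≫ Y.dFirst ≫ φ.inv := by
    rw [← Category.assoc, Iso.eq_comp_inv, hφ]
  obtain ⟨c, hc⟩ := hs.exists_pull_of_push_eq_zero hn hZ δ
    (by rw [hφ', push_comp, eX.push_dFirst, push_zero])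
  obtain ⟨f, hf, hcone⟩ := hs.good_lift ζ c X Z (by rwa [hc]) hZ
  have hf1 := hf.dFirst_comm
  rw [Category.id_comp, hφ'] at hf1
  -- The lift need not have `Y.dFirst` as its component in degree 1, but the difference factors
  -- through `X.K.d 1 2`, which kills `θ` as well.
  obtain ⟨k, hk⟩ := eX.exists_of_dFirst_comp hn (f.f 1 - Y.dFirst ≫ φ.inv)
    (by rw [Preadditive.comp_sub, hf1, sub_self])
  rw [eq_sub_iff_add_eq] at hk
  have h0 : push (Cpx.cone (X := X) (Y := Z) f).dFirst θ = 0 := by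
    have e : (biprod.lift (-X.K.d 1 2) (f.f 1) : X.K.X 1 ⟶ X.K.X 2 ⊞ Z.K.X 1) =
        X.K.d 1 2 ≫ biprod.lift (-𝟙 _) k + Y.dFirst ≫ φ.inv ≫ biprod.inr := by
      apply biprod.hom_ext <;> simp [hk]
    rw [cone_dFirst]
    refine (congr(push $e θ)).trans ?_
    rw [add_push, push_comp, hθ, push_zero, push_comp, eY.push_dFirst, push_zero, add_zero]
    rfl
  obtain ⟨t, ht⟩ := hs.exists_pull_of_push_eq_zero hn hcone θ h0
  exact ⟨pull t ζ, by rw [← pull_push, ht]⟩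

/-- Dual to `exists_push_dFirst`: compose deflations and use the cocone. -/
lemma exists_pull_dLast {m : ℕ} {s : Correspondence E (m + 1)} (hs : IsNExangulated s)
    {A B : C} {X : Cpx (m + 1) A B}
    {δ : ExtGrp E B A} (hX : Realizes s X δ) {T : C} (θ : ExtGrp E (X.K.X (m + 1)) T)
    (hθ : pull (X.K.d m (m + 1)) θ = 0) : ∃ η : ExtGrp E B T, pull X.dLast η = θ := by
  have eX := hs.isExangle _ _ hX
  obtain ⟨Y, hY⟩ := exists_realizes s θ
  have eY := hs.isExangle _ _ hY
  obtain ⟨D, Z, ζ, φ, hZ, hφ⟩ := hs.deflation_comp Y.dLast X.dLast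
    ⟨_, Y, θ, Iso.refl _, hY, by simp⟩ ⟨_, X, δ, Iso.refl _, hX, by simp⟩
  have hφ' : Z.dLast = φ.inv ≫ Y.dLast ≫ X.dLast := by
    rw [Iso.eq_inv_comp, hφ]
  obtain ⟨a, ha⟩ := hs.exists_push_of_pull_eq_zero hZ δ
    (by rw [hφ', pull_comp, pull_comp, eX.pull_dLast, pull_zero, pull_zero])
  obtain ⟨f, hf, hcone⟩ := hs.good_lift' ζ a Z X hZ (by rwa [ha])
  have hf1 := hf.dLast_comm
  rw [Category.comp_id, hφ'] at hf1
  obtain ⟨k, hk⟩ := eX.exists_of_comp_dLast (f.f (m + 1) - φ.inv ≫ Y.dLast)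
    (by rw [Preadditive.sub_comp, hf1, Category.assoc, sub_self])
  rw [eq_sub_iff_add_eq] at hk
  have h0 : pull (Cpx.cocone (X := Z) (Y := X) f).dLast θ = 0 := by
    rw [cocone_dLast]
    have e : (biprod.desc (Cpx.trOut Z.K (m + 1) (m + 1) ≫ f.f (m + 1))
        (-(Cpx.trOut X.K (m + 1) m ≫ X.K.d m (m + 1))) :
        Cpx.trX Z.K (m + 1) (m + 1) ⊞ Cpx.trX X.K (m + 1) m ⟶ X.K.X (m + 1)) =
        biprod.desc (Cpx.trOut Z.K (m + 1) (m + 1) ≫ k) (-Cpx.trOut X.K (m + 1) m) ≫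
          X.K.d m (m + 1) + (biprod.fst ≫ Cpx.trOut Z.K (m + 1) (m + 1) ≫ φ.inv) ≫ Y.dLast := by
      apply biprod.hom_ext' <;> simp [← hk]
    refine (congr(pull $e θ)).trans ?_
    rw [add_pull, pull_comp, hθ, pull_zero, pull_comp, eY.pull_dLast, pull_zero, add_zero]
    rfl
  obtain ⟨t, ht⟩ := hs.exists_push_of_pull_eq_zero hcone θ h0
  exact ⟨push t ζ, by rw [pull_push, ht]⟩

end IsNExangulated

end NEx

/-! ### Homotopy equivalences and direct sums of distinguished `n`-exangles -/

namespace NEx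

variable {C : Type u} [Category.{v} C] [Preadditive C] {E : Cᵒᵖ ⥤ C ⥤ AddCommGrpCat.{w}} {n : ℕ}
  {s : Correspondence E n}

section Homotopy

variable {A B : C} {X Y : Cpx n A B} {δ : ExtGrp E B A}

/-- A partial contracting homotopy of an endomorphism that vanishes in degree `0`. -/
lemma IsExangle.exists_partial_homotopy (hX : IsExangle X δ) (e : X.K ⟶ X.K) (h0 : e.f 0 = 0) :
    ∃ k : ∀ i, X.K.X (i + 1) ⟶ X.K.X i, k 0 = 0 ∧ ∀ i, i + 1 ≤ n →
      e.f (i + 1) = k i ≫ X.K.d i (i + 1) + X.K.d (i + 1) (i + 2) ≫ k (i + 1) := by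
  -- `Q i k` is the vanishing needed to apply `co_mid` and obtain the next component of the
  -- homotopy.
  let Q : ∀ i, (X.K.X (i + 1) ⟶ X.K.X i) → Prop := fun i k =>
    i + 1 ≤ n → X.K.d i (i + 1) ≫ (e.f (i + 1) - k ≫ X.K.d i (i + 1)) = 0
  have step : ∀ i k, Q i k → ∃ k', (i + 1 ≤ n →
      e.f (i + 1) = k ≫ X.K.d i (i + 1) + X.K.d (i + 1) (i + 2) ≫ k') ∧ Q (i + 1) k' := by
    intro i k hk
    by_cases hi : i + 1 ≤ n
    · obtain ⟨k', hk'⟩ := hX.co_mid i hi _ _ (hk hi)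
      refine ⟨k', fun _ => by rw [hk']; abel, fun _ => ?_⟩
      rw [Preadditive.comp_sub, ← Category.assoc, hk', Preadditive.sub_comp, ← e.comm]
      simp
    · exact ⟨0, fun h => absurd h hi, fun h => absurd h (by omega)⟩
  choose! next h1 h2 using step
  let k : ∀ i, {k : X.K.X (i + 1) ⟶ X.K.X i // Q i k} := fun i =>
    Nat.rec ⟨0, fun _ => by rw [zero_comp, sub_zero, ← e.comm, h0, zero_comp]⟩
      (fun i k => ⟨next i k.1, h2 i k.1 k.2⟩) i
  exact ⟨fun i => (k i).1, rfl, fun i hi => h1 i (k i).1 (k i).2 hi⟩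

/-- The partial homotopy may fail in degree `n + 1`. Composing it with `e` repairs this: there its
contribution becomes `k ≫ d ≫ e.f (n + 1) = 0`, as required. -/
lemma IsExangle.nonempty_homotopy_comp_self (hX : IsExangle X δ) (e : X.K ⟶ X.K) (h0 : e.f 0 = 0)
    (hlast : e.f (n + 1) = 0) : Nonempty (Homotopy (e ≫ e) 0) := by
  obtain ⟨k, hk0, hk⟩ := hX.exists_partial_homotopy e h0
  let h : ∀ i j, (ComplexShape.up ℕ).Rel j i → (X.K.X i ⟶ X.K.X j) := fun i j hij => by
    obtain rfl : j + 1 = i := hij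
    exact k j ≫ e.f j
  have key : e ≫ e = Homotopy.nullHomotopicMap' h := by
    ext i
    rw [HomologicalComplex.comp_f]
    rcases i with _ | i
    · rw [Homotopy.nullHomotopicMap'_f_of_not_rel_right (k₀ := 1) (k₁ := 0) rfl (by simp)]
      change e.f 0 ≫ e.f 0 = X.K.d 0 1 ≫ k 0 ≫ e.f 0
      simp [h0]
    · rw [Homotopy.nullHomotopicMap'_f (k₀ := i + 2) (k₁ := i + 1) (k₂ := i) rfl rfl]
      change _ = X.K.d (i + 1) (i + 2) ≫ k (i + 1) ≫ e.f (i + 1) + (k i ≫ e.f i) ≫ X.K.d i (i + 1)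
      rcases lt_trichotomy i n with hi | rfl | hi
      · nth_rw 1 [hk i hi]
        rw [Preadditive.add_comp, Category.assoc, Category.assoc, Category.assoc, e.comm]
        exact add_comm _ _
      · rw [Category.assoc, e.comm, hlast]
        simp
      · exact (X.isZero_X _ (by omega)).eq_of_src _ _
  exact ⟨(Homotopy.ofEq key).trans (Homotopy.nullHomotopy' h)⟩

lemma Cpx.IsLift.f_zero {f : X.K ⟶ X.K} (h : IsLift (X := X) (Y := X) f (𝟙 A) (𝟙 B)) :
    f.f 0 = 𝟙 _ := by
  have := h.1
  rwa [Category.comp_id, ← Iso.eq_comp_inv, Iso.hom_inv_id] at this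

lemma Cpx.IsLift.f_last {f : X.K ⟶ X.K} (h : IsLift (X := X) (Y := X) f (𝟙 A) (𝟙 B)) :
    f.f (n + 1) = 𝟙 _ := by
  have := h.2
  rwa [Category.comp_id, ← Iso.eq_comp_inv, Iso.hom_inv_id] at this

/-- Lifts of the identities in both directions suffice. The endomorphism `𝟙 - f ≫ g` squares to zero
up to homotopy, so `f ≫ g` is invertible up to homotopy, and correcting `g` makes it a homotopy
inverse of `f`. -/
lemma hEquiv_of_isLift {ρ : ExtGrp E B A} (hX : IsExangle X δ) (hY : IsExangle Y ρ)
    {f : X.K ⟶ Y.K} {g : Y.K ⟶ X.K} (hf : Cpx.IsLift (X := X) (Y := Y) f (𝟙 A) (𝟙 B))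
    (hg : Cpx.IsLift (X := Y) (Y := X) g (𝟙 A) (𝟙 B)) : Cpx.HEquiv X Y := by
  have hfg := hf.comp hg
  rw [Category.comp_id, Category.comp_id] at hfg
  obtain ⟨H⟩ := hX.nonempty_homotopy_comp_self (𝟙 _ - f ≫ g)
    (by rw [HomologicalComplex.sub_f_apply, hfg.f_zero]; simp)
    (by rw [HomologicalComplex.sub_f_apply, hfg.f_last]; simp)
  -- With `p = f ≫ g`, the choice `r = 2 - p` gives `p r = 1 - (1 - p)²`, homotopic to `1`.
  let r : X.K ⟶ X.K := 𝟙 _ + 𝟙 _ - f ≫ g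
  have hr : Cpx.IsLift (X := X) (Y := X) r (𝟙 A) (𝟙 B) := by
    have h0 := hfg.f_zero
    have h1 := hfg.f_last
    rw [HomologicalComplex.comp_f] at h0 h1
    constructor <;> simp [r, h0, h1]
  have hg' := hg.comp hr
  rw [Category.comp_id, Category.comp_id] at hg'
  have hgf := hg'.comp hf
  rw [Category.comp_id, Category.comp_id] at hgf
  have H1 : Homotopy (f ≫ g ≫ r) (𝟙 _) := by
    refine (Homotopy.equivSubZero.symm ((Homotopy.ofEq ?_).trans H)).symm
    simp only [r, Preadditive.comp_sub, Preadditive.comp_add, Preadditive.sub_comp,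
      Category.comp_id, Category.id_comp, Category.assoc]
    abel
  obtain ⟨H'⟩ := hY.nonempty_homotopy_comp_self (𝟙 _ - (g ≫ r) ≫ f)
    (by rw [HomologicalComplex.sub_f_apply, hgf.f_zero]; simp)
    (by rw [HomologicalComplex.sub_f_apply, hgf.f_last]; simp)
  have H3 : Homotopy ((g ≫ r) ≫ (f ≫ g ≫ r) ≫ f) ((g ≫ r) ≫ 𝟙 _ ≫ f) :=
    (H1.compRight f).compLeft (g ≫ r)
  -- By `H3`, `p = (g ≫ r) ≫ f` is idempotent up to homotopy, so `1 - p` is homotopic to `(1 - p)²`,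
  -- which is null-homotopic by `H'`.
  have H2 : Homotopy ((g ≫ r) ≫ f) (𝟙 _) := by
    refine (Homotopy.equivSubZero.symm ((Homotopy.ofEq ?_).trans
      ((H'.add (Homotopy.equivSubZero H3.symm)).trans (Homotopy.ofEq (zero_add _))))).symm
    simp only [Preadditive.comp_sub, Preadditive.sub_comp,
      Category.comp_id, Category.id_comp, Category.assoc]
    abel
  exact ⟨⟨f, g ≫ r, H1, H2⟩, hf, hg'⟩

end Homotopy

section Sum

variable [HasBinaryBiproducts C]

namespace Cpx

variable {A B A' B' : C} (X : Cpx n A B) (Y : Cpx n A' B')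

lemma isLift_inl : IsLift (X := X) (Y := X.sum Y) biprod.inl biprod.inl biprod.inl := by
  constructor <;>
  · simp only [Cpx.sum, Iso.trans_hom, biprod.mapIso_hom]
    apply biprod.hom_ext <;> simp [← HomologicalComplex.comp_f_assoc]

lemma isLift_inr : IsLift (X := Y) (Y := X.sum Y) biprod.inr biprod.inr biprod.inr := by
  constructor <;>
  · simp only [Cpx.sum, Iso.trans_hom, biprod.mapIso_hom]
    apply biprod.hom_ext <;> simp [← HomologicalComplex.comp_f_assoc]

lemma isLift_fst : IsLift (X := X.sum Y) (Y := X) biprod.fst biprod.fst biprod.fst := by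
  constructor <;> simp [Cpx.sum]

lemma isLift_snd : IsLift (X := X.sum Y) (Y := Y) biprod.snd biprod.snd biprod.snd := by
  constructor <;> simp [Cpx.sum]

end Cpx

variable [E.Additive] [∀ B : Cᵒᵖ, (E.obj B).Additive]

section

variable {A B A' B' : C} (δ : ExtGrp E B A) (ρ : ExtGrp E B' A')

lemma pull_inl_extSum : pull biprod.inl (extSum δ ρ) = push biprod.inl δ := by
  simp [extSum, pull_add, pull_push, ← pull_comp]

lemma pull_inr_extSum : pull biprod.inr (extSum δ ρ) = push biprod.inr ρ := by
  simp [extSum, pull_add, pull_push, ← pull_comp]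

lemma push_fst_extSum : push biprod.fst (extSum δ ρ) = pull biprod.fst δ := by
  simp [extSum, push_add, ← push_comp]

lemma push_snd_extSum : push biprod.snd (extSum δ ρ) = pull biprod.snd ρ := by
  simp [extSum, push_add, ← push_comp]

end

section Decomposition

variable {A B A' B' : C} {X : Cpx n A B} {Y : Cpx n A' B'} {W : Cpx n (A ⊞ A') (B ⊞ B')}
  {δ : ExtGrp E B A} {ρ : ExtGrp E B' A'}
  {i₁ : X.K ⟶ W.K} {i₂ : Y.K ⟶ W.K} {p₁ : W.K ⟶ X.K} {p₂ : W.K ⟶ Y.K}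

/-- A complex that decomposes into two `n`-exangles is an `n`-exangle. -/
lemma IsExangle.of_decomposition (hX : IsExangle X δ) (hY : IsExangle Y ρ)
    (hi₁ : Cpx.IsLift (X := X) (Y := W) i₁ biprod.inl biprod.inl)
    (hi₂ : Cpx.IsLift (X := Y) (Y := W) i₂ biprod.inr biprod.inr)
    (hp₁ : Cpx.IsLift (X := W) (Y := X) p₁ biprod.fst biprod.fst)
    (hp₂ : Cpx.IsLift (X := W) (Y := Y) p₂ biprod.snd biprod.snd)
    (total : p₁ ≫ i₁ + p₂ ≫ i₂ = 𝟙 _) : IsExangle W (extSum δ ρ) := by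
  have tot : ∀ i, p₁.f i ≫ i₁.f i + p₂.f i ≫ i₂.f i = 𝟙 (W.K.X i) := fun i => by
    have := congr($(total).f i)
    simpa using this
  have totl : ∀ {i : ℕ} {T : C} (g : T ⟶ W.K.X i),
      (g ≫ p₁.f i) ≫ i₁.f i + (g ≫ p₂.f i) ≫ i₂.f i = g := fun {i} {T} g => by
    rw [Category.assoc, Category.assoc, ← Preadditive.comp_add, tot, Category.comp_id]
  have totr : ∀ {i : ℕ} {T : C} (g : W.K.X i ⟶ T),
      p₁.f i ≫ i₁.f i ≫ g + p₂.f i ≫ i₂.f i ≫ g = g := fun {i} {T} g => by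
    rw [← Category.assoc, ← Category.assoc, ← Preadditive.add_comp, tot, Category.id_comp]
  constructor
  · intro i hi T g hg
    obtain ⟨h1, hh1⟩ := hX.contra_mid i hi T (g ≫ p₁.f (i + 1))
      (by rw [Category.assoc, HomologicalComplex.Hom.comm, reassoc_of% hg, zero_comp])
    obtain ⟨h2, hh2⟩ := hY.contra_mid i hi T (g ≫ p₂.f (i + 1))
      (by rw [Category.assoc, HomologicalComplex.Hom.comm, reassoc_of% hg, zero_comp])
    refine ⟨h1 ≫ i₁.f i + h2 ≫ i₂.f i, ?_⟩
    rw [Preadditive.add_comp, Category.assoc, Category.assoc, HomologicalComplex.Hom.comm,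
      HomologicalComplex.Hom.comm, ← Category.assoc, ← Category.assoc, hh1, hh2, totl]
  · intro T g
    have e1 := hi₁.dLast_comm
    have e2 := hi₂.dLast_comm
    constructor
    · intro hg
      obtain ⟨h1, hh1⟩ := (hX.contra_end T (g ≫ biprod.fst)).1
        (by rw [pull_comp, ← push_fst_extSum δ ρ, pull_push, hg, push_zero])
      obtain ⟨h2, hh2⟩ := (hY.contra_end T (g ≫ biprod.snd)).1
        (by rw [pull_comp, ← push_snd_extSum δ ρ, pull_push, hg, push_zero])
      refine ⟨h1 ≫ i₁.f n + h2 ≫ i₂.f n, ?_⟩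
      rw [Preadditive.add_comp, Category.assoc, Category.assoc, e1, e2,
        ← Category.assoc, ← Category.assoc, hh1, hh2, Category.assoc, Category.assoc,
        ← Preadditive.comp_add, biprod.total, Category.comp_id]
    · rintro ⟨h, rfl⟩
      rw [pull_comp, ← totr W.dLast, e1, e2,
        add_pull, pull_comp, pull_comp, pull_inl_extSum, pull_push, hX.pull_dLast,
        pull_comp, pull_comp, pull_inr_extSum, pull_push Y.dLast, hY.pull_dLast]
      simp
  · intro i hi T g hg
    obtain ⟨h1, hh1⟩ := hX.co_mid i hi T (i₁.f (i + 1) ≫ g)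
      (by rw [← HomologicalComplex.Hom.comm_assoc, hg, comp_zero])
    obtain ⟨h2, hh2⟩ := hY.co_mid i hi T (i₂.f (i + 1) ≫ g)
      (by rw [← HomologicalComplex.Hom.comm_assoc, hg, comp_zero])
    refine ⟨p₁.f (i + 2) ≫ h1 + p₂.f (i + 2) ≫ h2, ?_⟩
    rw [Preadditive.comp_add, ← HomologicalComplex.Hom.comm_assoc,
      ← HomologicalComplex.Hom.comm_assoc, hh1, hh2, totr]
  · intro T g
    have e1 := hp₁.dFirst_comm
    have e2 := hp₂.dFirst_comm
    constructor
    · intro hg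
      obtain ⟨h1, hh1⟩ := (hX.co_end T (biprod.inl ≫ g)).1
        (by rw [push_comp, ← pull_inl_extSum δ ρ, ← pull_push, hg, pull_zero])
      obtain ⟨h2, hh2⟩ := (hY.co_end T (biprod.inr ≫ g)).1
        (by rw [push_comp, ← pull_inr_extSum δ ρ, ← pull_push, hg, pull_zero])
      refine ⟨p₁.f 1 ≫ h1 + p₂.f 1 ≫ h2, ?_⟩
      rw [Preadditive.comp_add, ← Category.assoc, ← Category.assoc, e1, e2,
        Category.assoc, Category.assoc, hh1, hh2, ← Category.assoc, ← Category.assoc,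
        ← Preadditive.add_comp, biprod.total, Category.id_comp]
    · rintro ⟨h, rfl⟩
      rw [push_comp, ← totl W.dFirst, e1, e2,
        add_push, push_comp, push_comp, push_fst_extSum, ← pull_push, hX.push_dFirst,
        push_comp, push_comp, push_snd_extSum, ← pull_push _ Y.dFirst, hY.push_dFirst]
      simp

/-- Any realization `Z` of `extSum δ ρ` is compared with `W` by lifting the biproduct injections and
projections of the extensions and adding up; since both are `n`-exangles, `hEquiv_of_isLift`
applies. -/
lemma IsExactRealization.realizes_of_decomposition (hs : IsExactRealization s)
    (hX : Realizes s X δ) (hY : Realizes s Y ρ)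
    (hi₁ : Cpx.IsLift (X := X) (Y := W) i₁ biprod.inl biprod.inl)
    (hi₂ : Cpx.IsLift (X := Y) (Y := W) i₂ biprod.inr biprod.inr)
    (hp₁ : Cpx.IsLift (X := W) (Y := X) p₁ biprod.fst biprod.fst)
    (hp₂ : Cpx.IsLift (X := W) (Y := Y) p₂ biprod.snd biprod.snd)
    (total : p₁ ≫ i₁ + p₂ ≫ i₂ = 𝟙 _) : Realizes s W (extSum δ ρ) := by
  obtain ⟨Z, hZ⟩ := exists_realizes s (extSum δ ρ)
  obtain ⟨f1, hf1⟩ := hs.exists_lift X δ Z _ hX hZ biprod.inl biprod.inl (pull_inl_extSum δ ρ).symm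
  obtain ⟨f2, hf2⟩ := hs.exists_lift Y ρ Z _ hY hZ biprod.inr biprod.inr (pull_inr_extSum δ ρ).symm
  obtain ⟨g1, hg1⟩ := hs.exists_lift Z _ X δ hZ hX biprod.fst biprod.fst (push_fst_extSum δ ρ)
  obtain ⟨g2, hg2⟩ := hs.exists_lift Z _ Y ρ hZ hY biprod.snd biprod.snd (push_snd_extSum δ ρ)
  refine hZ.trans (Quotient.sound ?_)
  refine hEquiv_of_isLift (hs.isExangle _ _ hZ) ((hs.isExangle _ _ hX).of_decomposition
    (hs.isExangle _ _ hY) hi₁ hi₂ hp₁ hp₂ total)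
    (f := g1 ≫ i₁ + g2 ≫ i₂) (g := p₁ ≫ f1 + p₂ ≫ f2) ?_ ?_
  · have h1 := hg1.comp hi₁
    have h2 := hg2.comp hi₂
    exact ⟨by rw [HomologicalComplex.add_f_apply, Preadditive.add_comp, h1.1, h2.1,
        ← Preadditive.comp_add, biprod.total],
      by rw [HomologicalComplex.add_f_apply, Preadditive.add_comp, h1.2, h2.2,
        ← Preadditive.comp_add, biprod.total]⟩
  · have h1 := hp₁.comp hf1
    have h2 := hp₂.comp hf2
    exact ⟨by rw [HomologicalComplex.add_f_apply, Preadditive.add_comp, h1.1, h2.1,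
        ← Preadditive.comp_add, biprod.total],
      by rw [HomologicalComplex.add_f_apply, Preadditive.add_comp, h1.2, h2.2,
        ← Preadditive.comp_add, biprod.total]⟩

/-- The direct sum of distinguished `n`-exangles is distinguished. -/
lemma IsExactRealization.realizes_sum (hs : IsExactRealization s)
    (hX : Realizes s X δ) (hY : Realizes s Y ρ) : Realizes s (X.sum Y) (extSum δ ρ) :=
  hs.realizes_of_decomposition hX hY (Cpx.isLift_inl X Y) (Cpx.isLift_inr X Y)
    (Cpx.isLift_fst X Y) (Cpx.isLift_snd X Y) biprod.total

end Decomposition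

end Sum

end NEx

/-! ### `n`-proper classes and closed subbifunctors -/

namespace NEx

variable {C : Type u} [Category.{v} C] [Preadditive C] [HasZeroObject C] [HasBinaryBiproducts C]
  {E : Cᵒᵖ ⥤ C ⥤ AddCommGrpCat.{w}} [E.Additive] [∀ B : Cᵒᵖ, (E.obj B).Additive] {n : ℕ}
  {s : Correspondence E n}

/-- The diagonal pullback and codiagonal pushforward of a direct sum is the (Baer) sum. -/
lemma push_pull_extSum {A B : C} (δ ρ : ExtGrp E B A) :
    push (biprod.desc (𝟙 A) (𝟙 A)) (pull (biprod.lift (𝟙 B) (𝟙 B)) (extSum δ ρ)) = δ + ρ := by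
  simp [extSum, pull_add, push_add, pull_push, ← pull_comp, ← push_comp]

/-- A family of subgroups of `𝔼` that is stable under `a_*` and `c^*` and saturated. -/
structure IsSaturatedSubbifunctor (s : Correspondence E n)
    (F : ∀ B A : C, AddSubgroup (ExtGrp E B A)) : Prop where
  push_mem : ∀ {B A A' : C} (a : A ⟶ A') (δ : ExtGrp E B A), δ ∈ F B A → push a δ ∈ F B A'
  pull_mem : ∀ {B B' A : C} (c : B' ⟶ B) (δ : ExtGrp E B A), δ ∈ F B A → pull c δ ∈ F B' A
  saturated : ∀ {A A' B : C} (δ : ExtGrp E B A) (Y : Cpx n A' B) (ρ : ExtGrp E B A'),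
    Realizes s Y ρ → ρ ∈ F B A' → pull Y.dLast δ ∈ F (Y.K.X n) A → δ ∈ F B A

/-- The long exact sequences of `𝔼` provide a preimage `η`, and saturation puts it into `𝔽`. On the
right, saturation is applied along a realization `Y` of `θ = dFirst_* η`: the pullback of `η` to
`Yⁿ` dies in `X¹`, so it is a base change of `δ`. On the left, saturation along `X` itself is
enough. -/
lemma IsSaturatedSubbifunctor.isClosed (hs : IsNExangulated s) (hn : 1 ≤ n)
    {F : ∀ B A : C, AddSubgroup (ExtGrp E B A)} (hF : IsSaturatedSubbifunctor s F) :
    IsClosedSubbifunctor s F where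
  push_mem := hF.push_mem
  pull_mem := hF.pull_mem
  closed_right {A B} X δ hδ hX T θ hθ := by
    constructor
    · intro h
      obtain ⟨η, rfl⟩ := hs.exists_push_dFirst hn hX θ h
      obtain ⟨Y, hY⟩ := exists_realizes s (push X.dFirst η)
      obtain ⟨q, hq⟩ := hs.exists_pull_of_push_eq_zero hn hX (pull Y.dLast η)
        (by rw [← pull_push, (hs.isExangle _ _ hY).pull_dLast])
      exact ⟨η, hF.saturated η Y _ hY hθ (hq ▸ hF.pull_mem q δ hδ), rfl⟩
    · rintro ⟨η, -, rfl⟩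
      rw [← push_comp, dFirst_comp_d, zero_push]
  closed_left {A B} X δ hδ hX T θ hθ := by
    obtain ⟨m, rfl⟩ : ∃ m, n = m + 1 := ⟨n - 1, by omega⟩
    constructor
    · intro h
      obtain ⟨η, rfl⟩ := hs.exists_pull_dLast hX θ h
      exact ⟨η, hF.saturated η X δ hX hδ hθ, rfl⟩
    · rintro ⟨η, -, rfl⟩
      rw [← pull_comp, d_comp_dLast, zero_pull]

/-- Closedness on the left gives `η ∈ 𝔽` with the same pullback to `Yⁿ` as `δ`. The difference `δ -
η` vanishes there, so it is a cobase change of `ρ ∈ 𝔽`. -/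
lemma IsClosedSubbifunctor.isSaturated (hs : IsNExangulated s)
    {F : ∀ B A : C, AddSubgroup (ExtGrp E B A)} (hF : IsClosedSubbifunctor s F) :
    IsSaturatedSubbifunctor s F where
  push_mem := hF.push_mem
  pull_mem := hF.pull_mem
  saturated {A A' B} δ Y ρ hY hρ hδ := by
    obtain ⟨η, hη, h⟩ := (hF.closed_left Y ρ hρ hY A _ hδ).1
      (by rw [← pull_comp, d_comp_dLast, zero_pull])
    obtain ⟨a, ha⟩ := hs.exists_push_of_pull_eq_zero hY (δ - η) (by rw [pull_sub, h, sub_self])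
    have : δ - η ∈ F B A := ha ▸ hF.push_mem a ρ hρ
    simpa using add_mem this hη

/-- The class of distinguished `n`-exangles with extension in `𝔽`. -/
def properClass (s : Correspondence E n) (F : ∀ B A : C, AddSubgroup (ExtGrp E B A)) :
    Set (NPair E n) :=
  {P | Realizes s P.X P.δ ∧ P.δ ∈ F P.B P.A}

lemma IsClosedSubbifunctor.isNProperClass (hs : IsNExangulated s)
    {F : ∀ B A : C, AddSubgroup (ExtGrp E B A)} (hF : IsClosedSubbifunctor s F) :
    IsNProperClass s (properClass s F) where
  distinguished P hP := hP.1
  weak_iso P Q hP hQ f a c hf h := by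
    refine ⟨fun H => ⟨hQ, ?_⟩, fun H => ⟨hP, ?_⟩⟩
    · have h1 := hF.pull_mem c.inv _ (hF.push_mem a.hom _ H.2)
      rwa [h, ← pull_comp, Iso.inv_hom_id, pull_id] at h1
    · have h1 := hF.push_mem a.inv _ (hF.pull_mem c.hom _ H.2)
      rwa [← h, ← push_comp, Iso.hom_inv_id, push_id] at h1
  split P hP h := ⟨hP, h ▸ zero_mem _⟩
  sum P hP Q hQ := ⟨hs.realizes_sum hP.1 hQ.1,
    add_mem (hF.push_mem _ _ (hF.pull_mem _ _ hP.2)) (hF.push_mem _ _ (hF.pull_mem _ _ hQ.2))⟩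
  base_change P hP _ c Y hY := ⟨hY, hF.pull_mem _ _ hP.2⟩
  cobase_change P hP _ a Y hY := ⟨hY, hF.push_mem _ _ hP.2⟩
  saturated X δ Y ρ M hX hY hM := ⟨hX, (hF.isSaturated hs).saturated δ Y ρ hY.1 hY.2 hM.2⟩

namespace IsNProperClass

variable {ξ : Set (NPair E n)}

/-- Membership in `ξ` does not depend on the chosen realization: a lift of the identities is a weak
isomorphism. -/
lemma mem_of_realizes (hs : IsExactRealization s) (hξ : IsNProperClass s ξ) {A B : C}
    {X Y : Cpx n A B} {δ : ExtGrp E B A} (hX : (⟨A, B, X, δ⟩ : NPair E n) ∈ ξ)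
    (hY : Realizes s Y δ) : (⟨A, B, Y, δ⟩ : NPair E n) ∈ ξ := by
  have hX' := hξ.distinguished _ hX
  obtain ⟨f, hf⟩ := hs.exists_lift X δ Y δ hX' hY (𝟙 A) (𝟙 B) (by simp)
  exact (hξ.weak_iso ⟨A, B, X, δ⟩ ⟨A, B, Y, δ⟩ hX' hY f (Iso.refl A) (Iso.refl B) hf
    (by simp)).1 hX

/-- The subbifunctor `𝔼_ξ`. -/
def subbifunctor (hξ : IsNProperClass s ξ) (B A : C) :
    AddSubgroup (ExtGrp E B A) where
  carrier := {δ | ∃ X : Cpx n A B, (⟨A, B, X, δ⟩ : NPair E n) ∈ ξ}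
  zero_mem' := by
    obtain ⟨X, hX⟩ := exists_realizes s (0 : ExtGrp E B A)
    exact ⟨X, hξ.split ⟨A, B, X, 0⟩ hX rfl⟩
  neg_mem' := by
    rintro δ ⟨X, hX⟩
    -- `-δ` is the base change of `δ` along `-𝟙`.
    obtain ⟨Y, hY⟩ := exists_realizes s (pull (-𝟙 B) δ)
    have := hξ.base_change _ hX (-𝟙 B) Y hY
    refine ⟨Y, ?_⟩
    dsimp only at this
    rwa [neg_pull, pull_id] at this
  add_mem' := by
    rintro δ ρ ⟨X, hX⟩ ⟨Y, hY⟩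
    -- `δ + ρ` is the Baer sum: a coproduct, then a base change, then a cobase change.
    obtain ⟨Z, hZ⟩ := exists_realizes s (pull (biprod.lift (𝟙 B) (𝟙 B)) (extSum δ ρ))
    have h1 := hξ.base_change _ (hξ.sum _ hX _ hY) (biprod.lift (𝟙 B) (𝟙 B)) Z hZ
    obtain ⟨W, hW⟩ := exists_realizes s (push (biprod.desc (𝟙 A) (𝟙 A))
      (pull (biprod.lift (𝟙 B) (𝟙 B)) (extSum δ ρ)))
    have h2 := hξ.cobase_change _ h1 (biprod.desc (𝟙 A) (𝟙 A)) W hW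
    refine ⟨W, ?_⟩
    dsimp only at h2
    rwa [push_pull_extSum] at h2

lemma isSaturated_subbifunctor (hs : IsExactRealization s) (hξ : IsNProperClass s ξ) :
    IsSaturatedSubbifunctor s hξ.subbifunctor where
  push_mem a δ := by
    rintro ⟨X, hX⟩
    obtain ⟨Y, hY⟩ := exists_realizes s (push a δ)
    exact ⟨Y, hξ.cobase_change _ hX a Y hY⟩
  pull_mem c δ := by
    rintro ⟨X, hX⟩
    obtain ⟨Y, hY⟩ := exists_realizes s (pull c δ)
    exact ⟨Y, hξ.base_change _ hX c Y hY⟩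
  saturated δ Y ρ hY := by
    rintro ⟨Y', hY'⟩ ⟨M, hM⟩
    obtain ⟨X, hX⟩ := exists_realizes s δ
    exact ⟨X, hξ.saturated X δ Y ρ M hX (hξ.mem_of_realizes hs hY' hY) hM⟩

lemma mem_iff (hs : IsExactRealization s) (hξ : IsNProperClass s ξ) (P : NPair E n) :
    P ∈ ξ ↔ Realizes s P.X P.δ ∧ P.δ ∈ hξ.subbifunctor P.B P.A :=
  ⟨fun h => ⟨hξ.distinguished P h, P.X, h⟩, fun ⟨h, _, h'⟩ => hξ.mem_of_realizes hs h' h⟩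

end IsNProperClass

/-- The poset isomorphism between `n`-proper classes and closed subbifunctors. -/
def properClassOrderIso (hs : IsNExangulated s) (hn : 1 ≤ n) :
    {ξ : Set (NPair E n) // IsNProperClass s ξ} ≃o
      {F : ∀ B A : C, AddSubgroup (ExtGrp E B A) // IsClosedSubbifunctor s F} where
  toFun ξ := ⟨ξ.2.subbifunctor,
    (ξ.2.isSaturated_subbifunctor hs.toIsExactRealization).isClosed hs hn⟩
  invFun F := ⟨properClass s F.1, F.2.isNProperClass hs⟩
  left_inv ξ := Subtype.ext (Set.ext fun P => (ξ.2.mem_iff hs.toIsExactRealization P).symm)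
  right_inv F := by
    apply Subtype.ext
    funext B A
    ext δ
    refine ⟨fun ⟨X, hX⟩ => hX.2, fun h => ?_⟩
    obtain ⟨X, hX⟩ := exists_realizes s δ
    exact ⟨X, hX, h⟩
  map_rel_iff' {ξ ξ'} := by
    refine ⟨fun h P hP => ?_, fun h B A δ ⟨X, hX⟩ => ⟨X, h hX⟩⟩
    rw [ξ.2.mem_iff hs.toIsExactRealization] at hP
    rw [ξ'.2.mem_iff hs.toIsExactRealization]
    exact ⟨hP.1, h P.B P.A hP.2⟩

end NEx

/-! ### Contravariant defects and their elements -/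

namespace NEx

variable {C : Type u} [Category.{v} C] [Preadditive C] {n : ℕ}

section Pointwise

variable {F G H : Cᵒᵖ ⥤ AddCommGrpCat.{v}}

lemma mono_iff_app_injective (φ : F ⟶ G) :
    Mono φ ↔ ∀ T : C, Function.Injective (φ.app (op T)) := by
  rw [NatTrans.mono_iff_mono_app]
  exact ⟨fun h T => (AddCommGrpCat.mono_iff_injective _).1 (h (op T)),
    fun h T => (AddCommGrpCat.mono_iff_injective _).2 (h T.unop)⟩

lemma epi_iff_app_surjective (φ : F ⟶ G) :
    Epi φ ↔ ∀ T : C, Function.Surjective (φ.app (op T)) := by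
  rw [NatTrans.epi_iff_epi_app]
  exact ⟨fun h T => (AddCommGrpCat.epi_iff_surjective _).1 (h (op T)),
    fun h T => (AddCommGrpCat.epi_iff_surjective _).2 (h T.unop)⟩

lemma exact_iff_app (S : ShortComplex (Cᵒᵖ ⥤ AddCommGrpCat.{v})) :
    S.Exact ↔ ∀ (T : C) (x : S.X₂.obj (op T)), S.g.app (op T) x = 0 →
      ∃ y : S.X₁.obj (op T), S.f.app (op T) y = x := by
  have : S.Exact ↔ ∀ T : Cᵒᵖ, (S.map ((evaluation _ _).obj T)).Exact := by
    constructor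
    · intro h T
      exact h.map _
    · intro h
      rw [ShortComplex.exact_iff_isZero_homology, Functor.isZero_iff]
      intro T
      exact IsZero.of_iso ((ShortComplex.exact_iff_isZero_homology _).1 (h T))
        (S.mapHomologyIso ((evaluation _ _).obj T)).symm
  rw [this]
  exact ⟨fun h T x hx => (ShortComplex.ab_exact_iff _).1 (h (op T)) x hx,
    fun h T => (ShortComplex.ab_exact_iff _).2 (h T.unop)⟩

end Pointwise

variable {A B A' B' A'' B'' : C}

namespace Cpx

/-- The element of the contravariant defect represented by a morphism. -/
noncomputable def cls (X : Cpx n A B) {T : C} (u : T ⟶ B) : (defect X).obj (op T) :=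
  ((cokernel.π (preadditiveYoneda.map X.dLast)).app (op T)).hom u

variable (X : Cpx n A B)

lemma cls_sub {T : C} (u v : T ⟶ B) : X.cls (u - v) = X.cls u - X.cls v :=
  map_sub ((cokernel.π (preadditiveYoneda.map X.dLast)).app (op T)).hom u v

lemma cls_surjective {T : C} (x : (defect X).obj (op T)) : ∃ u : T ⟶ B, X.cls u = x :=
  (epi_iff_app_surjective (cokernel.π (preadditiveYoneda.map X.dLast))).1 inferInstance T x

lemma cls_eq_zero_iff {T : C} (u : T ⟶ B) :
    X.cls u = 0 ↔ ∃ t : T ⟶ X.K.X n, t ≫ X.dLast = u := by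
  constructor
  · exact (exact_iff_app _).1 (ShortComplex.exact_cokernel (preadditiveYoneda.map X.dLast)) T u
  · rintro ⟨t, rfl⟩
    have := congr($(cokernel.condition (preadditiveYoneda.map X.dLast)).app (op T))
    exact congr($(this).hom t)

lemma map_cls {T T' : C} (u : T ⟶ B) (v : T' ⟶ T) :
    (defect X).map v.op (X.cls u) = X.cls (v ≫ u) :=
  congr($((cokernel.π (preadditiveYoneda.map X.dLast)).naturality v.op).hom u).symm

end Cpx

/-- A Yoneda argument: `c` is any representative of the image of the class of `𝟙 B`. -/
lemma exists_app_cls {X : Cpx n A B} {Y : Cpx n A' B'} (φ : defect X ⟶ defect Y) :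
    ∃ c : B ⟶ B', ∀ (T : C) (u : T ⟶ B), φ.app (op T) (X.cls u) = Y.cls (u ≫ c) := by
  obtain ⟨c, hc⟩ := Y.cls_surjective (φ.app (op B) (X.cls (𝟙 B)))
  refine ⟨c, fun T u => ?_⟩
  rw [← Y.map_cls, hc, ← NatTrans.naturality_apply, X.map_cls, Category.comp_id]

lemma exists_defectMap {X : Cpx n A B} {Y : Cpx n A' B'} (c : B ⟶ B')
    (h : Y.cls (X.dLast ≫ c) = 0) : ∃ φ : defect X ⟶ defect Y,
      ∀ (T : C) (u : T ⟶ B), φ.app (op T) (X.cls u) = Y.cls (u ≫ c) := by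
  obtain ⟨t, ht⟩ := (Y.cls_eq_zero_iff _).1 h
  have hw : preadditiveYoneda.map X.dLast ≫ preadditiveYoneda.map c ≫
      cokernel.π (preadditiveYoneda.map Y.dLast) = 0 := by
    rw [← Category.assoc, ← Functor.map_comp, ← ht, Functor.map_comp, Category.assoc,
      cokernel.condition, comp_zero]
  let φ : defect X ⟶ defect Y := cokernel.desc _ (preadditiveYoneda.map c ≫ cokernel.π _) hw
  have hφ : cokernel.π (preadditiveYoneda.map X.dLast) ≫ φ =
    preadditiveYoneda.map c ≫ cokernel.π _ := cokernel.π_desc _ _ _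
  exact ⟨φ, fun T u => congr($(congr($(hφ).app (op T))).hom u)⟩

variable {E : Cᵒᵖ ⥤ C ⥤ AddCommGrpCat.{w}}

/-- This embeds the defect into `𝔼(-, A)` by `u ↦ u^*δ`. -/
lemma IsExangle.cls_eq_zero_iff {X : Cpx n A B} {δ : ExtGrp E B A} (h : IsExangle X δ) {T : C}
    (u : T ⟶ B) : X.cls u = 0 ↔ pull u δ = 0 := by
  rw [X.cls_eq_zero_iff, h.contra_end]

lemma IsExangle.cls_eq_iff [E.Additive] {X : Cpx n A B} {δ : ExtGrp E B A} (h : IsExangle X δ)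
    {T : C} (u v : T ⟶ B) : X.cls u = X.cls v ↔ pull u δ = pull v δ := by
  rw [← sub_eq_zero, ← X.cls_sub, h.cls_eq_zero_iff, ← sub_eq_zero (a := pull u δ),
    sub_eq_add_neg, sub_eq_add_neg, add_pull, neg_pull]

end NEx

/-! ### Monomorphisms, epimorphisms and exactness in `def 𝔼` -/

namespace NEx

variable {C : Type u} [Category.{v} C] [Preadditive C] [HasZeroObject C] [HasBinaryBiproducts C]
  {E : Cᵒᵖ ⥤ C ⥤ AddCommGrpCat.{w}} [E.Additive] [∀ B : Cᵒᵖ, (E.obj B).Additive] {n : ℕ}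
  {s : Correspondence E n}

section Elements

variable {G H K : (defE s).FullSubcategory} {T T' : C}

/-- The action of a morphism of `def 𝔼` on elements. -/
def ev (f : G ⟶ H) (x : G.obj.obj (op T)) : H.obj.obj (op T) := f.hom.app (op T) x

/-- The restriction of an element along a morphism of `C`. -/
def res (v : T' ⟶ T) (x : G.obj.obj (op T)) : G.obj.obj (op T') := G.obj.map v.op x

lemma ev_comp (f : G ⟶ H) (g : H ⟶ K) (x : G.obj.obj (op T)) : ev (f ≫ g) x = ev g (ev f x) := rfl

lemma ev_id (x : G.obj.obj (op T)) : ev (𝟙 G) x = x := rfl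

lemma ev_zero (x : G.obj.obj (op T)) : ev (0 : G ⟶ H) x = 0 := rfl

lemma ev_map_zero (f : G ⟶ H) : ev f (0 : G.obj.obj (op T)) = 0 := map_zero (f.hom.app (op T)).hom

lemma res_map_zero (v : T' ⟶ T) : res v (0 : G.obj.obj (op T)) = 0 :=
  map_zero (G.obj.map v.op).hom

lemma ev_res (f : G ⟶ H) (v : T' ⟶ T) (x : G.obj.obj (op T)) : ev f (res v x) = res v (ev f x) :=
  NatTrans.naturality_apply f.hom v.op x

lemma hom_ext_ev {f g : G ⟶ H} (h : ∀ (T : C) (x : G.obj.obj (op T)), ev f x = ev g x) :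
    f = g := by
  apply ObjectProperty.hom_ext
  ext T x
  exact h T.unop x

lemma ev_inv_hom (e : G ≅ H) (x : H.obj.obj (op T)) : ev e.hom (ev e.inv x) = x := by
  rw [← ev_comp, e.inv_hom_id, ev_id]

lemma ev_hom_inv (e : G ≅ H) (x : G.obj.obj (op T)) : ev e.inv (ev e.hom x) = x := by
  rw [← ev_comp, e.hom_inv_id, ev_id]

end Elements

section Morphisms

variable {A B A' B' : C} {X : Cpx n A B} {δ : ExtGrp E B A} {Y : Cpx n A' B'} {ρ : ExtGrp E B' A'}

/-- The contravariant defect of a distinguished `n`-exangle as an object of `def 𝔼`. -/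
noncomputable def defObj (hX : Realizes s X δ) : (defE s).FullSubcategory :=
  ⟨defect X, ⟨_, _, X, δ, trivial, hX, ⟨Iso.refl _⟩⟩⟩

/-- The element of the contravariant defect represented by a morphism. -/
noncomputable def el (hX : Realizes s X δ) {T : C} (u : T ⟶ B) : (defObj hX).obj.obj (op T) :=
  X.cls u

lemma el_surjective (hX : Realizes s X δ) {T : C} (x : (defObj hX).obj.obj (op T)) :
    ∃ u : T ⟶ B, el hX u = x := X.cls_surjective x

lemma res_el (hX : Realizes s X δ) {T T' : C} (v : T' ⟶ T) (u : T ⟶ B) :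
    res v (el hX u) = el hX (v ≫ u) := X.map_cls u v

lemma el_eq_zero_iff (hs : IsExactRealization s) (hX : Realizes s X δ) {T : C} (u : T ⟶ B) :
    el hX u = 0 ↔ pull u δ = 0 := (hs.isExangle X δ hX).cls_eq_zero_iff u

lemma el_eq_iff (hs : IsExactRealization s) (hX : Realizes s X δ) {T : C} (u v : T ⟶ B) :
    el hX u = el hX v ↔ pull u δ = pull v δ := (hs.isExangle X δ hX).cls_eq_iff u v

lemma exists_iso_defObj {F : ∀ B A : C, AddSubgroup (ExtGrp E B A)}
    {G : (defE s).FullSubcategory} (hG : defOf s F G.obj) :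
    ∃ (A B : C) (X : Cpx n A B) (δ : ExtGrp E B A) (_ : δ ∈ F B A) (hX : Realizes s X δ),
      Nonempty (G ≅ defObj hX) := by
  obtain ⟨A, B, X, δ, hδ, hX, ⟨e⟩⟩ := hG
  exact ⟨A, B, X, δ, hδ, hX, ⟨(defE s).isoMk e⟩⟩

variable {G H K : (defE s).FullSubcategory}

lemma defObj_hom_ext (hX : Realizes s X δ) {f g : defObj hX ⟶ G}
    (h : ∀ (T : C) (u : T ⟶ B), ev f (el hX u) = ev g (el hX u)) : f = g :=
  hom_ext_ev fun T x => by
    obtain ⟨u, rfl⟩ := el_surjective hX x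
    exact h T u

lemma exists_defObj_hom (hs : IsExactRealization s) (hX : Realizes s X δ) (hY : Realizes s Y ρ)
    (c : B ⟶ B') (h : pull X.dLast (pull c ρ) = 0) : ∃ f : defObj hX ⟶ defObj hY,
      ∀ (T : C) (u : T ⟶ B), ev f (el hX u) = el hY (u ≫ c) := by
  obtain ⟨φ, hφ⟩ := exists_defectMap (X := X) (Y := Y) c
    (by rw [(hs.isExangle _ _ hY).cls_eq_zero_iff, pull_comp, h])
  exact ⟨(defE s).homMk φ, hφ⟩

lemma exists_ev_el (hs : IsExactRealization s) {hX : Realizes s X δ} {hY : Realizes s Y ρ}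
    (f : defObj hX ⟶ defObj hY) : ∃ c : B ⟶ B', pull X.dLast (pull c ρ) = 0 ∧
      ∀ (T : C) (u : T ⟶ B), ev f (el hX u) = el hY (u ≫ c) := by
  obtain ⟨c, hc⟩ : ∃ c : B ⟶ B', ∀ (T : C) (u : T ⟶ B), ev f (el hX u) = el hY (u ≫ c) :=
    exists_app_cls (X := X) (Y := Y) f.hom
  refine ⟨c, ?_, hc⟩
  rw [← pull_comp, ← el_eq_zero_iff hs hY, ← hc,
    (el_eq_zero_iff hs hX _).2 (hs.isExangle _ _ hX).pull_dLast, ev_map_zero]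

/-- Every element of a functor in `def 𝔼` is the image of the canonical generator of a defect. -/
lemma exists_ev_el_id_eq (hs : IsExactRealization s) (G : (defE s).FullSubcategory) {T : C}
    (x : G.obj.obj (op T)) : ∃ (A : C) (Z : Cpx n A T) (ζ : ExtGrp E T A) (hZ : Realizes s Z ζ)
      (f : defObj hZ ⟶ G), ev f (el hZ (𝟙 T)) = x := by
  obtain ⟨A, B, X, δ, -, hX, ⟨e⟩⟩ := exists_iso_defObj G.property
  obtain ⟨u, hu⟩ := el_surjective hX (ev e.hom x)
  -- The defect of `u^*δ` is the subfunctor generated by `x`.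
  obtain ⟨Z, hZ⟩ := exists_realizes s (pull u δ)
  obtain ⟨f, hf⟩ := exists_defObj_hom hs hZ hX u (hs.isExangle _ _ hZ).pull_dLast
  refine ⟨A, Z, _, hZ, f ≫ e.inv, ?_⟩
  rw [ev_comp, hf, Category.id_comp, hu, ev_hom_inv]

lemma comp_eq_zero_of_ev {hX : Realizes s X δ} (f : defObj hX ⟶ G) (g : G ⟶ H)
    (h : ev g (ev f (el hX (𝟙 B))) = 0) : f ≫ g = 0 := by
  refine defObj_hom_ext hX fun T u => ?_
  rw [← Category.comp_id u, ← res_el, ev_res, ev_comp, h, res_map_zero, ev_zero]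

/-- An element killed by `f` is the image of a generator under a morphism inside `def 𝔼` that `f`
kills, so cancellation in the full subcategory already detects it. -/
lemma mono_iff_ev (hs : IsExactRealization s) (f : G ⟶ H) :
    Mono f ↔ ∀ (T : C) (x : G.obj.obj (op T)), ev f x = 0 → x = 0 := by
  constructor
  · intro hf T x hx
    obtain ⟨A, Z, ζ, hZ, i, rfl⟩ := exists_ev_el_id_eq hs G x
    rw [zero_of_comp_mono f (comp_eq_zero_of_ev i f hx), ev_zero]
  · intro h
    refine Preadditive.mono_of_cancel_zero f fun g hg => hom_ext_ev fun T x => ?_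
    rw [ev_zero]
    exact h _ _ (by rw [← ev_comp, hg, ev_zero])

lemma epi_of_ev_surjective (f : G ⟶ H)
    (h : ∀ (T : C) (y : H.obj.obj (op T)), ∃ x, ev f x = y) : Epi f := by
  refine Preadditive.epi_of_cancel_zero f fun g hg => hom_ext_ev fun T y => ?_
  obtain ⟨x, rfl⟩ := h T y
  rw [← ev_comp, hg, ev_zero, ev_zero]

/-- The pointwise cokernel of `f` lies in `def 𝔼`: if `f` is given by `c` and `V` realizes `c^*ρ`,
it is the defect of `V.dFirst_* ρ`. For epi `f` the projection `p` vanishes, and exactness of the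
long sequence of `V` gives preimages. -/
lemma ev_surjective_of_epi (hs : IsNExangulated s) (hn : 1 ≤ n) (f : G ⟶ H) [Epi f] {T : C}
    (y : H.obj.obj (op T)) : ∃ x, ev f x = y := by
  have hs' := hs.toIsExactRealization
  obtain ⟨A, B, X, δ, -, hX, ⟨e⟩⟩ := exists_iso_defObj G.property
  obtain ⟨A', B', Y, ρ, -, hY, ⟨e'⟩⟩ := exists_iso_defObj H.property
  obtain ⟨c, hc0, hc⟩ := exists_ev_el hs' (e.inv ≫ f ≫ e'.hom)
  obtain ⟨V, hV⟩ := exists_realizes s (pull c ρ)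
  obtain ⟨W, hW⟩ := exists_realizes s (push V.dFirst ρ)
  obtain ⟨p, hp⟩ := exists_defObj_hom hs' hY hW (𝟙 B')
    (by rw [pull_id, pull_push, (hs.isExangle _ _ hY).pull_dLast, push_zero])
  have h0 : (e.inv ≫ f ≫ e'.hom) ≫ p = 0 := by
    refine defObj_hom_ext hX fun T u => ?_
    rw [ev_comp, hc, hp, ev_zero, Category.comp_id, el_eq_zero_iff hs',
      pull_push, pull_comp, ← pull_push, (hs.isExangle _ _ hV).push_dFirst, pull_zero]
  have hp0 : p = 0 := by rwa [← cancel_epi (e.inv ≫ f ≫ e'.hom), comp_zero]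
  obtain ⟨v, hv⟩ := el_surjective hY (ev e'.hom y)
  have h1 := hp T v
  rw [hp0, ev_zero, Category.comp_id, eq_comm, el_eq_zero_iff hs', pull_push] at h1
  obtain ⟨t, ht⟩ := hs.exists_pull_of_push_eq_zero hn hV _ h1
  refine ⟨ev e.inv (el hX t), ?_⟩
  have h2 := hc T t
  rw [(el_eq_iff hs' hY _ v).2 (by rw [pull_comp, ht]), hv, ev_comp, ev_comp] at h2
  rw [← ev_hom_inv e' (ev f _), h2, ev_hom_inv]

lemma isZero_defObj (hs : IsExactRealization s) (hX : Realizes s X δ) (h : δ = 0) :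
    IsZero (defObj hX) := by
  rw [IsZero.iff_id_eq_zero]
  refine defObj_hom_ext hX fun T u => ?_
  rw [ev_id, ev_zero, el_eq_zero_iff hs, h, pull_zero]

lemma mono_defObj_iff (hs : IsExactRealization s) {hX : Realizes s X δ} {hY : Realizes s Y ρ}
    {f : defObj hX ⟶ defObj hY} {c : B ⟶ B'}
    (hf : ∀ (T : C) (u : T ⟶ B), ev f (el hX u) = el hY (u ≫ c)) :
    Mono f ↔ ∀ (T : C) (u : T ⟶ B), pull u (pull c ρ) = 0 → pull u δ = 0 := by
  rw [mono_iff_ev hs]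
  constructor
  · intro h T u hu
    rw [← el_eq_zero_iff hs hX]
    exact h T _ (by rw [hf, el_eq_zero_iff hs, pull_comp, hu])
  · intro h T x hx
    obtain ⟨u, rfl⟩ := el_surjective hX x
    rw [hf, el_eq_zero_iff hs, pull_comp] at hx
    rw [el_eq_zero_iff hs, h T u hx]

lemma epi_defObj {hX : Realizes s X δ} {hY : Realizes s Y ρ} {f : defObj hX ⟶ defObj hY}
    {c : B ⟶ B'} (hf : ∀ (T : C) (u : T ⟶ B), ev f (el hX u) = el hY (u ≫ c))
    (t : B' ⟶ B) (ht : t ≫ c = 𝟙 B') : Epi f := by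
  refine epi_of_ev_surjective f fun T y => ?_
  obtain ⟨v, rfl⟩ := el_surjective hY y
  exact ⟨el hX (v ≫ t), by rw [hf, Category.assoc, ht, Category.comp_id]⟩

end Morphisms

section Exactness

/-- The generator of an element killed by `S.g` maps to the categorical kernel, onto which `S.X₁`
maps epimorphically, hence surjectively on elements. -/
lemma exists_ev_eq_of_exact (hs : IsNExangulated s) (hn : 1 ≤ n)
    {S : ShortComplex (defE s).FullSubcategory} (hS : S.Exact) {T : C} (x : S.X₂.obj.obj (op T))
    (hx : ev S.g x = 0) : ∃ y : S.X₁.obj.obj (op T), ev S.f y = x := by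
  obtain ⟨A, Z, ζ, hZ, i, rfl⟩ := exists_ev_el_id_eq hs.toIsExactRealization S.X₂ x
  have hi := comp_eq_zero_of_ev i S.g hx
  have := hS.hasHomology
  have := hS.epi_f' S.leftHomologyData
  obtain ⟨y, hy⟩ := ev_surjective_of_epi hs hn S.leftHomologyData.f'
    (ev (S.leftHomologyData.liftK i hi) (el hZ (𝟙 T)))
  refine ⟨y, ?_⟩
  rw [← S.leftHomologyData.f'_i, ev_comp, hy, ← ev_comp, S.leftHomologyData.liftK_i]

/-- A short complex in which `f` is a kernel of `g` and `g` is a cokernel of `f` is short exact. -/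
lemma shortExact_of_isLimit_of_isColimit {D : Type*} [Category* D] [Preadditive D]
    [HasZeroObject D] (S : ShortComplex D) (hf : IsLimit (KernelFork.ofι S.f S.zero))
    (hg : IsColimit (CokernelCofork.ofπ S.g S.zero)) : S.ShortExact := by
  have hmono : Mono S.f := mono_of_isLimit_fork hf
  have hepi : Epi S.g := epi_of_isColimit_cofork hg
  have h1 : hf.lift (KernelFork.ofι S.f S.zero) = 𝟙 S.X₁ := by
    rw [← cancel_mono S.f]
    exact (Fork.IsLimit.lift_ι hf).trans (Category.id_comp _).symm
  have h2 : hg.desc (CokernelCofork.ofπ S.g S.zero) = 𝟙 S.X₃ := by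
    rw [← cancel_epi S.g]
    exact (Cofork.IsColimit.π_desc hg).trans (Category.comp_id _).symm
  -- `D` is only preadditive, so exactness is shown by explicit homology data, with `H = 0` on both
  -- sides.
  let l : S.LeftHomologyData :=
    { K := S.X₁
      H := 0
      i := S.f
      π := 0
      wi := S.zero
      hi := hf
      wπ := comp_zero
      hπ := CokernelCofork.IsColimit.ofπ _ _ (fun _ _ => 0)
        (fun k hk => by
          rw [h1] at hk
          rw [zero_comp, ← hk]
          exact Category.id_comp k)
        (fun _ _ _ _ => (isZero_zero D).eq_of_src _ _) }
  let r : S.RightHomologyData :=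
    { Q := S.X₃
      H := 0
      p := S.g
      ι := 0
      wp := S.zero
      hp := hg
      wι := zero_comp
      hι := KernelFork.IsLimit.ofι _ _ (fun _ _ => 0)
        (fun k hk => by
          rw [h2] at hk
          rw [comp_zero, ← hk]
          exact Category.comp_id k)
        (fun _ _ _ _ => (isZero_zero D).eq_of_tgt _ _) }
  exact { exact := ⟨⟨⟨l, r, Iso.refl _, by simp [l, r]⟩, isZero_zero D⟩⟩ }

/-- Pointwise exactness yields a kernel and a cokernel in the functor category, and the fully
faithful inclusion reflects both. -/
lemma shortExact_of_ev [HasZeroObject (defE s).FullSubcategory]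
    (S : ShortComplex (defE s).FullSubcategory)
    (hf : ∀ (T : C) (x : S.X₁.obj.obj (op T)), ev S.f x = 0 → x = 0)
    (h : ∀ (T : C) (x : S.X₂.obj.obj (op T)), ev S.g x = 0 → ∃ y, ev S.f y = x)
    (hg : ∀ (T : C) (y : S.X₃.obj.obj (op T)), ∃ x, ev S.g x = y) : S.ShortExact := by
  have h0 : S.f.hom ≫ S.g.hom = 0 := congr(InducedCategory.Hom.hom $S.zero)
  have hS : (ShortComplex.mk S.f.hom S.g.hom h0).Exact := (exact_iff_app _).2 h
  have : Mono S.f.hom := (mono_iff_app_injective _).2 fun T =>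
    (injective_iff_map_eq_zero (S.f.hom.app (op T)).hom).2 (hf T)
  have : Epi S.g.hom := (epi_iff_app_surjective _).2 hg
  refine shortExact_of_isLimit_of_isColimit S ?_ ?_
  · exact isLimitOfReflects (defE s).ι ((KernelFork.isLimitMapConeEquiv _ _).symm hS.fIsKernel)
  · exact isColimitOfReflects (defE s).ι
      ((CokernelCofork.isColimitMapCoconeEquiv _ _).symm hS.gIsCokernel)

end Exactness

end NEx

/-! ### Closed subbifunctors and Serre subcategories of `def 𝔼` -/

namespace NEx

variable {C : Type u} [Category.{v} C] [Preadditive C] [HasZeroObject C] [HasBinaryBiproducts C]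
  {E : Cᵒᵖ ⥤ C ⥤ AddCommGrpCat.{w}} [E.Additive] [∀ B : Cᵒᵖ, (E.obj B).Additive] {n : ℕ}
  {s : Correspondence E n}

lemma hasZeroObject_defE (hs : IsExactRealization s) : HasZeroObject (defE s).FullSubcategory := by
  obtain ⟨X, hX⟩ := exists_realizes s (0 : ExtGrp E (0 : C) (0 : C))
  exact ⟨_, isZero_defObj hs hX rfl⟩

section OfSubbifunctor

variable {F : ∀ B A : C, AddSubgroup (ExtGrp E B A)}

/-- `def 𝔽` as a full subcategory of `def 𝔼`. -/
def defSub (s : Correspondence E n) (F : ∀ B A : C, AddSubgroup (ExtGrp E B A)) :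
    ObjectProperty (defE s).FullSubcategory := fun G => defOf s F G.obj

variable {A B A' B' : C} {X : Cpx n A B} {δ : ExtGrp E B A} {Y : Cpx n A' B'} {ρ : ExtGrp E B' A'}

lemma defSub_of_iso {G H : (defE s).FullSubcategory} (e : G ≅ H) (h : defSub s F H) :
    defSub s F G := by
  obtain ⟨A, B, X, δ, hδ, hX, ⟨i⟩⟩ := h
  exact ⟨A, B, X, δ, hδ, hX, ⟨(defE s).ι.mapIso e ≪≫ i⟩⟩

lemma defSub_defObj (hX : Realizes s X δ) (hδ : δ ∈ F B A) : defSub s F (defObj hX) :=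
  ⟨_, _, X, δ, hδ, hX, ⟨Iso.refl _⟩⟩

variable (hF : IsClosedSubbifunctor s F)

include hF

/-- Being a morphism of defects forces `c^*ρ = a_*δ`; a preimage `t` of the generator then gives `ρ
= t^* c^*ρ = t^* a_*δ`. -/
lemma IsClosedSubbifunctor.mem_of_epi (hs : IsNExangulated s) (hn : 1 ≤ n) {hX : Realizes s X δ}
    {hY : Realizes s Y ρ} (f : defObj hX ⟶ defObj hY) [Epi f] (hδ : δ ∈ F B A) :
    ρ ∈ F B' A' := by
  obtain ⟨c, hc0, hc⟩ := exists_ev_el hs.toIsExactRealization f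
  obtain ⟨a, ha⟩ := hs.exists_push_of_pull_eq_zero hX _ hc0
  obtain ⟨x, hx⟩ := ev_surjective_of_epi hs hn f (el hY (𝟙 B'))
  obtain ⟨t, rfl⟩ := el_surjective hX x
  rw [hc, el_eq_iff hs.toIsExactRealization, pull_id, pull_comp, ← ha] at hx
  exact hx ▸ hF.pull_mem t _ (hF.push_mem a _ hδ)

/-- If `V` realizes `c^*ρ`, then `V.dLast` represents an element killed by `f`, so it pulls `δ` back
to zero and `δ = a_* c^*ρ`. -/
lemma IsClosedSubbifunctor.mem_of_mono (hs : IsNExangulated s) {hX : Realizes s X δ}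
    {hY : Realizes s Y ρ} (f : defObj hX ⟶ defObj hY) [Mono f] (hρ : ρ ∈ F B' A') :
    δ ∈ F B A := by
  obtain ⟨c, hc0, hc⟩ := exists_ev_el hs.toIsExactRealization f
  obtain ⟨V, hV⟩ := exists_realizes s (pull c ρ)
  obtain ⟨a, ha⟩ := hs.exists_push_of_pull_eq_zero hV δ
    ((mono_defObj_iff hs.toIsExactRealization hc).1 inferInstance _ _
      (hs.isExangle _ _ hV).pull_dLast)
  exact ha ▸ hF.push_mem a _ (hF.pull_mem c _ hρ)

/-- This recovers `𝔽` from `def 𝔽`: no extension outside `𝔽` can share its defect with one inside.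
-/
lemma IsClosedSubbifunctor.defSub_defObj_iff (hs : IsNExangulated s) (hX : Realizes s X δ) :
    defSub s F (defObj hX) ↔ δ ∈ F B A := by
  refine ⟨fun h => ?_, defSub_defObj hX⟩
  obtain ⟨A', B', Y, ρ, hρ, hY, ⟨e⟩⟩ := exists_iso_defObj h
  exact hF.mem_of_mono hs e.hom hρ

/-- Saturation is applied along a realization `V` of `d^*δ₃`: the class of `V.dLast` is killed by
`g`, so it comes from the first term and the pullback of `δ₂` along `V.dLast` has the form `t^*
a_*δ₁`. -/
lemma IsClosedSubbifunctor.mem_of_exact (hs : IsNExangulated s)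
    {A₁ A₂ A₃ B₁ B₂ B₃ : C} {X₁ : Cpx n A₁ B₁} {X₂ : Cpx n A₂ B₂} {X₃ : Cpx n A₃ B₃}
    {δ₁ : ExtGrp E B₁ A₁} {δ₂ : ExtGrp E B₂ A₂} {δ₃ : ExtGrp E B₃ A₃}
    {h₁ : Realizes s X₁ δ₁} {h₂ : Realizes s X₂ δ₂} {h₃ : Realizes s X₃ δ₃}
    (f : defObj h₁ ⟶ defObj h₂) (g : defObj h₂ ⟶ defObj h₃)
    (hfg : ∀ (T : C) (x : (defObj h₂).obj.obj (op T)), ev g x = 0 → ∃ y, ev f y = x)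
    (m₁ : δ₁ ∈ F B₁ A₁) (m₃ : δ₃ ∈ F B₃ A₃) : δ₂ ∈ F B₂ A₂ := by
  have hs' := hs.toIsExactRealization
  obtain ⟨c, hc0, hc⟩ := exists_ev_el hs' f
  obtain ⟨d, hd0, hd⟩ := exists_ev_el hs' g
  obtain ⟨V, hV⟩ := exists_realizes s (pull d δ₃)
  obtain ⟨a, ha⟩ := hs.exists_push_of_pull_eq_zero h₁ _ hc0
  obtain ⟨y, hy⟩ := hfg _ (el h₂ V.dLast) (by
    rw [hd, el_eq_zero_iff hs', pull_comp, (hs.isExangle _ _ hV).pull_dLast])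
  obtain ⟨t, rfl⟩ := el_surjective h₁ y
  rw [hc, el_eq_iff hs', pull_comp, ← ha] at hy
  exact (hF.isSaturated hs).saturated δ₂ V _ hV (hF.pull_mem d _ m₃)
    (hy ▸ hF.pull_mem t _ (hF.push_mem a _ m₁))

lemma IsClosedSubbifunctor.isSerreSubcategory (hs : IsNExangulated s) (hn : 1 ≤ n) :
    IsSerreSubcategory (defSub s F) where
  containsZero := by
    obtain ⟨X, hX⟩ := exists_realizes s (0 : ExtGrp E (0 : C) (0 : C))
    exact ⟨_, isZero_defObj hs.toIsExactRealization hX rfl, defSub_defObj hX (zero_mem _)⟩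
  subobjects := ⟨fun {G H} f _ hH => by
    obtain ⟨A, B, X, δ, -, hX, ⟨e⟩⟩ := exists_iso_defObj G.property
    obtain ⟨A', B', Y, ρ, hρ, hY, ⟨e'⟩⟩ := exists_iso_defObj hH
    exact defSub_of_iso e (defSub_defObj hX (hF.mem_of_mono hs (e.inv ≫ f ≫ e'.hom) hρ))⟩
  quotients := ⟨fun {G H} f _ hG => by
    obtain ⟨A, B, X, δ, hδ, hX, ⟨e⟩⟩ := exists_iso_defObj hG
    obtain ⟨A', B', Y, ρ, -, hY, ⟨e'⟩⟩ := exists_iso_defObj H.property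
    exact defSub_of_iso e' (defSub_defObj hY (hF.mem_of_epi hs hn (e.inv ≫ f ≫ e'.hom) hδ))⟩
  extensions := ⟨fun {S} hS m₁ m₃ => by
    obtain ⟨A₁, B₁, X₁, δ₁, m₁, h₁, ⟨e₁⟩⟩ := exists_iso_defObj m₁
    obtain ⟨A₂, B₂, X₂, δ₂, -, h₂, ⟨e₂⟩⟩ := exists_iso_defObj S.X₂.property
    obtain ⟨A₃, B₃, X₃, δ₃, m₃, h₃, ⟨e₃⟩⟩ := exists_iso_defObj m₃
    refine defSub_of_iso e₂ (defSub_defObj h₂ (hF.mem_of_exact hs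
      (e₁.inv ≫ S.f ≫ e₂.hom) (e₂.inv ≫ S.g ≫ e₃.hom) (fun T x hx => ?_) m₁ m₃))
    rw [ev_comp, ev_comp] at hx
    have hx' : ev S.g (ev e₂.inv x) = 0 := by
      rw [← ev_hom_inv e₃ (ev S.g _), hx, ev_map_zero]
    obtain ⟨y, hy⟩ := exists_ev_eq_of_exact hs hn hS.exact _ hx'
    exact ⟨ev e₁.hom y, by rw [ev_comp, ev_comp, ev_hom_inv, hy, ev_inv_hom]⟩⟩

end OfSubbifunctor

namespace IsSerreSubcategory

variable {S : ObjectProperty (defE s).FullSubcategory}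

section

variable {A B A' B' : C} {X : Cpx n A B} {δ : ExtGrp E B A} {Y : Cpx n A' B'} {ρ : ExtGrp E B' A'}

lemma prop_of_mono (hS : IsSerreSubcategory S) {G H : (defE s).FullSubcategory} (f : G ⟶ H)
    [Mono f] (h : S H) : S G :=
  hS.subobjects.prop_of_mono f h

lemma prop_of_epi (hS : IsSerreSubcategory S) {G H : (defE s).FullSubcategory} (f : G ⟶ H)
    [Epi f] (h : S G) : S H :=
  hS.quotients.prop_of_epi f h

lemma prop_of_isZero (hS : IsSerreSubcategory S) {G : (defE s).FullSubcategory} (h : IsZero G) :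
    S G := by
  obtain ⟨Z, hZ, hSZ⟩ := hS.containsZero.exists_zero
  exact hS.prop_of_mono (h.iso hZ).hom hSZ

/-- Base change produces a subfunctor of the defect. -/
lemma prop_defObj_pull (hs : IsExactRealization s) (hS : IsSerreSubcategory S)
    (hX : Realizes s X δ) (c : B' ⟶ B) {Z : Cpx n A B'} (hZ : Realizes s Z (pull c δ))
    (h : S (defObj hX)) : S (defObj hZ) := by
  obtain ⟨f, hf⟩ := exists_defObj_hom hs hZ hX c (hs.isExangle _ _ hZ).pull_dLast
  have : Mono f := (mono_defObj_iff hs hf).2 fun T u hu => hu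
  exact hS.prop_of_mono f h

/-- Cobase change produces a quotient of the defect. -/
lemma prop_defObj_push (hs : IsExactRealization s) (hS : IsSerreSubcategory S)
    (hX : Realizes s X δ) (a : A ⟶ A') {Z : Cpx n A' B} (hZ : Realizes s Z (push a δ))
    (h : S (defObj hX)) : S (defObj hZ) := by
  obtain ⟨f, hf⟩ := exists_defObj_hom hs hX hZ (𝟙 B)
    (by rw [pull_id, pull_push, (hs.isExangle _ _ hX).pull_dLast, push_zero])
  have : Epi f := epi_defObj hf (𝟙 B) (Category.comp_id _)
  exact hS.prop_of_epi f h

lemma prop_defObj_of_realizes (hs : IsExactRealization s) (hS : IsSerreSubcategory S)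
    {X X' : Cpx n A B} (hX : Realizes s X δ) (hX' : Realizes s X' δ) (h : S (defObj hX)) :
    S (defObj hX') := by
  have := hS.prop_defObj_pull hs hX (𝟙 B) (Z := X') (by rwa [pull_id]) h
  simpa only [pull_id] using this

lemma prop_defObj_of_eq (hs : IsExactRealization s) (hS : IsSerreSubcategory S)
    {X X' : Cpx n A B} {δ' : ExtGrp E B A} (hX : Realizes s X δ) (hX' : Realizes s X' δ')
    (e : δ = δ') (h : S (defObj hX)) : S (defObj hX') := by
  subst e
  exact hS.prop_defObj_of_realizes hs hX hX' h

/-- The defect of a direct sum is an extension of the two defects. -/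
lemma prop_defObj_extSum (hs : IsExactRealization s) (hS : IsSerreSubcategory S)
    (hX : Realizes s X δ) (hY : Realizes s Y ρ) {W : Cpx n (A ⊞ A') (B ⊞ B')}
    (hW : Realizes s W (extSum δ ρ)) (h : S (defObj hX)) (h' : S (defObj hY)) :
    S (defObj hW) := by
  obtain ⟨f, hf⟩ := exists_defObj_hom hs hX hW biprod.inl
    (by rw [pull_inl_extSum, pull_push, (hs.isExangle _ _ hX).pull_dLast, push_zero])
  obtain ⟨g, hg⟩ := exists_defObj_hom hs hW hY biprod.snd
    (by rw [← push_snd_extSum δ ρ, pull_push, (hs.isExangle _ _ hW).pull_dLast, push_zero])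
  have zero : f ≫ g = 0 := defObj_hom_ext hX fun T u => by
    rw [ev_comp, hf, hg, ev_zero, el_eq_zero_iff hs, Category.assoc, biprod.inl_snd, comp_zero,
      zero_pull]
  have := hasZeroObject_defE hs
  refine hS.extensions.prop_X₂_of_shortExact (S := ShortComplex.mk f g zero)
    (shortExact_of_ev _ ?_ ?_ ?_) h h'
  · refine (mono_iff_ev hs f).1 ((mono_defObj_iff hs hf).2 fun T u hu => ?_)
    rw [pull_inl_extSum, pull_push] at hu
    have := congr(push biprod.fst $hu)
    rwa [← push_comp, biprod.inl_fst, push_id, push_zero] at this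
  · intro T x hx
    obtain ⟨v, rfl⟩ := el_surjective hW x
    replace hx := (hg T v).symm.trans hx
    rw [el_eq_zero_iff hs, pull_comp] at hx
    refine ⟨el hX (v ≫ biprod.fst), (hf _ _).trans ?_⟩
    rw [el_eq_iff hs, pull_comp, pull_inl_extSum, pull_push, pull_comp, extSum, pull_add,
      pull_push, pull_push v, hx, push_zero, add_zero]
  · intro T y
    obtain ⟨v, rfl⟩ := el_surjective hY y
    exact ⟨el hW (v ≫ biprod.inr), (hg _ _).trans (by simp)⟩

/-- Saturation from closure under extensions. With `W` realizing `Z.dFirst_* δ`, the defects of `Z`,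
`X` and `W` form a short exact sequence. As `Y.dLast` pulls `Z.dFirst_* δ` back to zero, the defect
of `W` is a quotient of that of `Y`. -/
lemma prop_defObj_of_pull (hs : IsNExangulated s) (hn : 1 ≤ n) (hS : IsSerreSubcategory S)
    {ρ : ExtGrp E B A'} {Y : Cpx n A' B} {Z : Cpx n A (Y.K.X n)}
    (hX : Realizes s X δ) (hY : Realizes s Y ρ) (hZ : Realizes s Z (pull Y.dLast δ))
    (h : S (defObj hY)) (h' : S (defObj hZ)) : S (defObj hX) := by
  have hs' := hs.toIsExactRealization
  obtain ⟨W, hW⟩ := exists_realizes s (push Z.dFirst δ)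
  have hpW : pull Y.dLast (push Z.dFirst δ) = 0 := by
    rw [pull_push, (hs.isExangle _ _ hZ).push_dFirst]
  obtain ⟨q, hq⟩ := exists_defObj_hom hs' hY hW (𝟙 B) (by rw [pull_id, hpW])
  have : Epi q := epi_defObj hq (𝟙 B) (Category.comp_id _)
  have hSW : S (defObj hW) := hS.prop_of_epi q h
  obtain ⟨f, hf⟩ := exists_defObj_hom hs' hZ hX Y.dLast (hs.isExangle _ _ hZ).pull_dLast
  obtain ⟨g, hg⟩ := exists_defObj_hom hs' hX hW (𝟙 B)
    (by rw [pull_id, pull_push, (hs.isExangle _ _ hX).pull_dLast, push_zero])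
  have zero : f ≫ g = 0 := defObj_hom_ext hZ fun T u => by
    rw [ev_comp, hf, hg, ev_zero, el_eq_zero_iff hs', Category.comp_id, pull_comp, hpW, pull_zero]
  have := hasZeroObject_defE hs'
  refine hS.extensions.prop_X₂_of_shortExact (S := ShortComplex.mk f g zero)
    (shortExact_of_ev _ ?_ ?_ ?_) h' hSW
  · exact (mono_iff_ev hs' f).1 ((mono_defObj_iff hs' hf).2 fun T u hu => hu)
  · intro T x hx
    obtain ⟨v, rfl⟩ := el_surjective hX x
    replace hx := (hg T v).symm.trans hx
    rw [el_eq_zero_iff hs', Category.comp_id, pull_push] at hx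
    obtain ⟨t, ht⟩ := hs.exists_pull_of_push_eq_zero hn hZ _ hx
    exact ⟨el hZ t, (hf _ _).trans ((el_eq_iff hs' hX _ _).2 (by rw [pull_comp, ht]))⟩
  · intro T y
    obtain ⟨v, rfl⟩ := el_surjective hW y
    exact ⟨el hX v, (hg _ _).trans (by rw [Category.comp_id])⟩

end

/-- The extensions whose realizations have their contravariant defect in `S`. -/
def subbifunctor (hs : IsNExangulated s) (hS : IsSerreSubcategory S) (B A : C) :
    AddSubgroup (ExtGrp E B A) where
  carrier := {δ | ∃ (X : Cpx n A B) (hX : Realizes s X δ), S (defObj hX)}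
  zero_mem' := by
    obtain ⟨X, hX⟩ := exists_realizes s (0 : ExtGrp E B A)
    exact ⟨X, hX, hS.prop_of_isZero (isZero_defObj hs.toIsExactRealization hX rfl)⟩
  neg_mem' := by
    rintro δ ⟨X, hX, h⟩
    obtain ⟨Y, hY⟩ := exists_realizes s (-δ)
    exact ⟨Y, hY, hS.prop_defObj_of_eq hs.toIsExactRealization (X := Y)
      (by rwa [neg_pull, pull_id]) hY (by rw [neg_pull, pull_id])
      (hS.prop_defObj_pull hs.toIsExactRealization hX (-𝟙 B) (by rwa [neg_pull, pull_id]) h)⟩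
  add_mem' := by
    rintro δ ρ ⟨X, hX, h⟩ ⟨Y, hY, h'⟩
    have hs' := hs.toIsExactRealization
    obtain ⟨W, hW⟩ := exists_realizes s (extSum δ ρ)
    have h1 := hS.prop_defObj_extSum hs' hX hY hW h h'
    obtain ⟨V, hV⟩ := exists_realizes s (pull (biprod.lift (𝟙 B) (𝟙 B)) (extSum δ ρ))
    have h2 := hS.prop_defObj_pull hs' hW _ hV h1
    obtain ⟨U, hU⟩ := exists_realizes s (push (biprod.desc (𝟙 A) (𝟙 A))
      (pull (biprod.lift (𝟙 B) (𝟙 B)) (extSum δ ρ)))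
    have h3 := hS.prop_defObj_push hs' hV _ hU h2
    obtain ⟨Z, hZ⟩ := exists_realizes s (δ + ρ)
    exact ⟨Z, hZ, hS.prop_defObj_of_eq hs' hU hZ (push_pull_extSum δ ρ) h3⟩

lemma mem_subbifunctor_iff (hs : IsNExangulated s) (hS : IsSerreSubcategory S) {A B : C}
    {X : Cpx n A B} {δ : ExtGrp E B A} (hX : Realizes s X δ) :
    δ ∈ hS.subbifunctor hs B A ↔ S (defObj hX) :=
  ⟨fun ⟨_, hX', h⟩ => hS.prop_defObj_of_realizes hs.toIsExactRealization hX' hX h,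
    fun h => ⟨X, hX, h⟩⟩

lemma isSaturated_subbifunctor (hs : IsNExangulated s) (hn : 1 ≤ n) (hS : IsSerreSubcategory S) :
    IsSaturatedSubbifunctor s (hS.subbifunctor hs) where
  push_mem a δ := by
    rintro ⟨X, hX, h⟩
    obtain ⟨Y, hY⟩ := exists_realizes s (push a δ)
    exact ⟨Y, hY, hS.prop_defObj_push hs.toIsExactRealization hX a hY h⟩
  pull_mem c δ := by
    rintro ⟨X, hX, h⟩
    obtain ⟨Y, hY⟩ := exists_realizes s (pull c δ)
    exact ⟨Y, hY, hS.prop_defObj_pull hs.toIsExactRealization hX c hY h⟩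
  saturated δ Y ρ hY hρ := by
    rintro ⟨Z, hZ, h⟩
    obtain ⟨X, hX⟩ := exists_realizes s δ
    exact ⟨X, hX, hS.prop_defObj_of_pull hs hn hX hY hZ
      ((hS.mem_subbifunctor_iff hs hY).1 hρ) h⟩

end IsSerreSubcategory

/-- The poset isomorphism between closed subbifunctors and Serre subcategories of `def 𝔼`. -/
def defSubOrderIso (hs : IsNExangulated s) (hn : 1 ≤ n) :
    {F : ∀ B A : C, AddSubgroup (ExtGrp E B A) // IsClosedSubbifunctor s F} ≃o
      {S : ObjectProperty (defE s).FullSubcategory // IsSerreSubcategory S} where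
  toFun F := ⟨defSub s F.1, F.2.isSerreSubcategory hs hn⟩
  invFun S := ⟨S.2.subbifunctor hs, (S.2.isSaturated_subbifunctor hs hn).isClosed hs hn⟩
  left_inv F := by
    apply Subtype.ext
    funext B A
    ext δ
    obtain ⟨X, hX⟩ := exists_realizes s δ
    rw [IsSerreSubcategory.mem_subbifunctor_iff hs _ hX]
    exact F.2.defSub_defObj_iff hs hX
  right_inv S := by
    apply Subtype.ext
    funext G
    refine propext ⟨fun h => ?_, fun h => ?_⟩
    · obtain ⟨A, B, X, δ, hδ, hX, ⟨e⟩⟩ := exists_iso_defObj h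
      exact S.2.prop_of_mono e.hom ((S.2.mem_subbifunctor_iff hs hX).1 hδ)
    · obtain ⟨A, B, X, δ, -, hX, ⟨e⟩⟩ := exists_iso_defObj G.property
      exact defSub_of_iso e (defSub_defObj hX
        ((S.2.mem_subbifunctor_iff hs hX).2 (S.2.prop_of_mono e.inv h)))
  map_rel_iff' {F F'} := by
    refine ⟨fun h B A δ hδ => ?_, fun h G ⟨A, B, X, δ, hδ, hX⟩ => ⟨A, B, X, δ, h B A hδ, hX⟩⟩
    -- The order is reflected because membership of `δ` can be read off from the defect of any one
    -- realization.
    obtain ⟨X, hX⟩ := exists_realizes s δ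
    exact (F'.2.defSub_defObj_iff hs hX).1 (h _ (defSub_defObj hX hδ))

end NEx

theorem corollary4p9 {C : Type u} [Category.{v} C] [Preadditive C] [HasZeroObject C] [HasBinaryBiproducts C]
    [EssentiallySmall.{v} C] [HasWeakKernels C] (n : ℕ) (hn : 1 ≤ n)
    (E : Cᵒᵖ ⥤ C ⥤ AddCommGrpCat.{w}) [E.Additive] [∀ B : Cᵒᵖ, (E.obj B).Additive]
    (s : NEx.Correspondence E n) (hs : NEx.IsNExangulated s) :
    ∃ (Φ : {ξ : Set (NEx.NPair E n) // NEx.IsNProperClass s ξ} ≃o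
          {S : ObjectProperty (NEx.defE s).FullSubcategory // NEx.IsSerreSubcategory S})
      (Φ₁ : {ξ : Set (NEx.NPair E n) // NEx.IsNProperClass s ξ} ≃o
          {F : ∀ B A : C, AddSubgroup (NEx.ExtGrp E B A) // NEx.IsClosedSubbifunctor s F})
      (Φ₂ : {F : ∀ B A : C, AddSubgroup (NEx.ExtGrp E B A) // NEx.IsClosedSubbifunctor s F} ≃o
          {S : ObjectProperty (NEx.defE s).FullSubcategory // NEx.IsSerreSubcategory S}),
      Φ = Φ₁.trans Φ₂ ∧
      (∀ (ξ : {ξ : Set (NEx.NPair E n) // NEx.IsNProperClass s ξ}) (B A : C)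
        (δ : NEx.ExtGrp E B A),
        δ ∈ (Φ₁ ξ).1 B A ↔ ∃ X : NEx.Cpx n A B, (⟨A, B, X, δ⟩ : NEx.NPair E n) ∈ ξ.1) ∧
      (∀ (F : {F : ∀ B A : C, AddSubgroup (NEx.ExtGrp E B A) // NEx.IsClosedSubbifunctor s F})
        (G : (NEx.defE s).FullSubcategory), (Φ₂ F).1 G ↔ NEx.defOf s F.1 G.obj) := by
  exact ⟨(NEx.properClassOrderIso hs hn).trans (NEx.defSubOrderIso hs hn),
    NEx.properClassOrderIso hs hn, NEx.defSubOrderIso hs hn, rfl,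
    fun ξ B A δ => Iff.rfl, fun F G => Iff.rfl⟩
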